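/- Let $0<b_0<L$, $\Omega=(0,L)$, $\Gamma=\partial\Omega=\{0,L\}$, with outer normals $\nu(0)=-1$, $\nu(L)=1$. Let $H=L^2(\Omega)\times L^2(\Gamma)$ with its standard inner product (counting measure on $\Gamma$), and let $E:H\to[0,\infty]$, $$E(u,v)=\int_\Omega|Du|+\sum_{x\in\Gamma}|\gamma u(x)-v(x)|\quad\text{if }u\in BV(\Omega),\qquad E(u,v)=+\infty\quad\text{otherwise},$$ where $\gamma$ is the trace. A solution with initial value $U_0\in H$ is a $U\in W^{1,2}_{loc}([0,\infty);H)$ with $U(0)=U_0$ and $\frac{dU}{dt}(t)\in-\partial E(U(t))$ for a.e. $t>0$. *Facets.* A facet is an interval $F=[p,q]\subseteq[0,L]$, $p<q$, with a direction $d\in C(\Omega\setminus F;\{\pm1\})$. A Cahn–Hoffman field on $(F,d)$ is a $z\in L^\infty(F)$ with $\|z\|_\infty\le1$, $\operatorname{div}z\in L^2(F)$, whose normal trace $[z\cdot\nu_F]$ equals, at each point of $\partial F\cap\Omega$, the trace of $d$ from the complement of $F$. Put $\Gamma_F=\partial F\cap\Gamma$ and, for $\tau>0$, $I_\tau(z)=\int_F|\operatorname{div}z|^2dx+\frac1\tau\sum_{\Gamma_F}[z\cdot\nu_F]^2$.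 The facet is calibrable (the parameter $\tau$ being fixed) if some Cahn–Hoffman field minimizing $I_\tau$ has $\operatorname{div}z$ constant on $F$ and $[z\cdot\nu_F]$ constant on $\Gamma_F$; it is $(\tau,\Gamma)$-coherent if some minimizer of $I_\tau$ satisfies $\tau\lambda_z+\mu_z=0$, where $\lambda_z,\mu_z$ are the means of $\operatorname{div}z$ over $F$ and of $[z\cdot\nu_F]$ over $\Gamma_F$. Below $\tau=1$. **Theorem.** Let $u_0$ be Lipschitz on $[0,L]$, strictly monotone on $[0,b_0]$ and constant on $[b_0,L]$; put $\chi=1$ if $u_0$ is increasing and $\chi=-1$ if it is decreasing. Let $v_0=u_0|_\Gamma$. Then there is a unique solution $U=(u,v)$ with $U(0)=(u_0,v_0)$, and there are a time $T_{cr}>0$ and functions $a,b,h_l,h_r$ on $[0,T_{cr}]$ with values $a(t),b(t)\in[0,b_0]$ such that $a<b$ on $[0,T_{cr})$, $a(T_{cr})=b(T_{cr})$, and the following hold. (Derivatives at $t=0$ are one-sided.) 1. $b(0)=b_0$, $h_r(0)=u_0(L)$, $u_0(b(t))=h_r(t)$ on $[0,T_{cr}]$ (that is, $b(t)=(u_0|_{[0,b_0]})^{-1}(h_r(t))$),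 and for $0\le t<T_{cr}$ $$\frac{dh_r}{dt}(t)=\frac{-\chi}{1+L-b(t)}.$$ For every $0\le t<T_{cr}$ the facet $[b(t),L]$, with constant direction $-\chi$ (that is, $z(b(t))=\chi$ for its Cahn–Hoffman fields), is calibrable and $(1,\Gamma)$-coherent. 2. A facet forms instantly at $0$: $a(0)=0$ and $a(t)>0$ for $0<t\le T_{cr}$. Moreover $h_l(0)=u_0(0)$, $u_0(a(t))=h_l(t)$ on $[0,T_{cr}]$ (that is, $a(t)=(u_0|_{[0,b_0]})^{-1}(h_l(t))$), and for $0\le t<T_{cr}$ $$\frac{dh_l}{dt}(t)=\frac{\chi}{1+a(t)}.$$ In particular its initial velocity is $\chi$, and the velocity is continuous at $t=0$. For every $0<t<T_{cr}$ the facet $[0,a(t)]$, with constant direction $\chi$, is calibrable and $(1,\Gamma)$-coherent. 3. For $0\le t\le T_{cr}$, $$u(x,t)=\begin{cases}h_l(t),&x\in[0,a(t)],\\u_0(x),&x\in(a(t),b(t)),\\h_r(t),&x\in[b(t),L],\end{cases}\qquad v(0,t)=h_l(t),\quad v(L,t)=h_r(t),$$ and for $t\ge T_{cr}$ both $u(\cdot,t)$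 and $v(\cdot,t)$ are constant, equal to $h_l(T_{cr})=h_r(T_{cr})$. For $0\le t<T_{cr}$ the right derivative $(u_t,v_t)$ of $U$ in $H$ exists, with $u_t=\frac{\chi}{1+a(t)}$ on $(0,a(t))$, $u_t=0$ on $(a(t),b(t))$, $u_t=\frac{-\chi}{1+L-b(t)}$ on $(b(t),L)$, $v_t(0)=\frac{\chi}{1+a(t)}$ and $v_t(L)=\frac{-\chi}{1+L-b(t)}$. For all $t\ge0$, $u(t)\in BV(\Omega)$ and $\gamma u(t)=v(t)$; for all $t>0$ the right derivative $(u_t,v_t)$ of $U$ in $H$ exists and $\gamma u_t=v_t$. -/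

import Mathlib

open MeasureTheory Set Filter Topology
open scoped ENNReal NNReal InnerProductSpace

noncomputable section

namespace TVFlow

/-! ### Subdifferentials and gradient flows in a Hilbert space -/

section Abstract

variable {X : Type*} [NormedAddCommGroup X] [InnerProductSpace ℝ X]

/-- The subdifferential `∂Φ(w)` of a functional `Φ : X → [0, ∞]`. -/
def subdifferential (Φ : X → ℝ≥0∞) (w : X) : Set X :=
  {η | Φ w ≠ ∞ ∧ ∀ w', Φ w' ≠ ∞ → ⟪η, w' - w⟫_ℝ ≤ (Φ w').toReal - (Φ w).toReal}

/-- `w ∈ W^{1,2}_loc([0,∞); X)` (continuous representative) solves `dw/dt ∈ -∂Φ(w)` for a.e.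
`t > 0`, `w(0) = w₀`; here `g` is the weak time derivative of `w`. Only the values `w t`
with `0 ≤ t` matter. -/
def IsGradientFlow (Φ : X → ℝ≥0∞) (w₀ : X) (w : ℝ → X) : Prop :=
  ∃ g : ℝ → X,
    (∀ T : ℝ, MemLp g 2 (volume.restrict (Ioc 0 T))) ∧
    (∀ t : ℝ, 0 ≤ t → w t = w₀ + ∫ s in (0 : ℝ)..t, g s) ∧
    ∀ᵐ t ∂volume.restrict (Ioi (0 : ℝ)), -(g t) ∈ subdifferential Φ (w t)

end Abstract

/-! ### The energy on the interval `Ω = (0, L)` with `Γ = ∂Ω = {0, L}` -/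

/-- The points of `Γ = {0, L}`: index `0` is the point `0`, index `1` is the point `L`. -/
def endpt (L : ℝ) : Fin 2 → ℝ := ![0, L]

/-- `H = L²(Ω) × L²(Γ)` with the inner product `∫_Ω u₁ u₂ dx + ∑_{Γ} v₁ v₂`
(on `Γ = {0, L}` the measure `H⁰` is counting measure). -/
abbrev H (L : ℝ) : Type :=
  WithLp 2 (Lp ℝ 2 (volume.restrict (Ioo 0 L)) × EuclideanSpace ℝ (Fin 2))

/-- The total variation `|Du|(0, L)`. -/
def totalVar (L : ℝ) (u : ℝ → ℝ) : ℝ≥0∞ :=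
  ⨆ φ ∈ {φ : ℝ → ℝ | ContDiff ℝ 1 φ ∧ HasCompactSupport φ ∧ tsupport φ ⊆ Ioo 0 L ∧
      ∀ x, |φ x| ≤ 1},
    ENNReal.ofReal (∫ x in Ioo 0 L, u x * deriv φ x)

/-- The mean of `u` over the part of `Ω` within distance `r` of the `i`-th end point. -/
def endMean (L : ℝ) (u : ℝ → ℝ) (i : Fin 2) (r : ℝ) : ℝ :=
  r⁻¹ * ∫ x in (if i = 0 then Ioo 0 r else Ioo (L - r) L), u x

/-- `u` has the boundary trace `c` at the `i`-th end point. -/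
def HasTrace (L : ℝ) (u : ℝ → ℝ) (i : Fin 2) (c : ℝ) : Prop :=
  Tendsto (endMean L u i) (𝓝[>] 0) (𝓝 c)

/-- The trace operator `γ`; the limit exists for every `u ∈ BV(0, L)`. -/
def trace (L : ℝ) (u : ℝ → ℝ) (i : Fin 2) : ℝ :=
  limUnder (𝓝[>] 0) (endMean L u i)

open Classical in
/-- `E(u, v) = ∫_Ω |Du| + ∑_Γ |γu - v|` if `u ∈ BV(Ω)`, and `+∞` otherwise. -/
def energy (L : ℝ) (U : H L) : ℝ≥0∞ :=
  if totalVar L U.fst < ∞ then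
    totalVar L U.fst + ∑ i, ENNReal.ofReal |trace L U.fst i - U.snd i|
  else ∞

/-! ### Facets, Cahn–Hoffman fields, calibrability and coherence -/

/-- The interval `F = [p, q] ⊆ [0, L]` with direction `d ∈ C(Ω \ F; {±1})` is a facet
(with Lipschitz boundary) in `Ω = (0, L)`. -/
structure IsFacet (L p q : ℝ) (d : ℝ → ℝ) : Prop where
  nonneg : 0 ≤ p
  lt : p < q
  le : q ≤ L
  cont : ContinuousOn d (Ioo 0 L \ Icc p q)
  values : ∀ x ∈ Ioo 0 L \ Icc p q, d x = 1 ∨ d x = -1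

/-- `z` is a Cahn–Hoffman field on the facet `F = [p, q]` with direction `d`,
`w = div z ∈ L²(F)`, and `n 0`, `n 1` are the normal traces `[z·ν_F]` at `p`, `q`.
The field `green` says both that `w` is the weak divergence of `z` and that `n` is the
normal trace. On `∂F ∩ Ω` the normal trace is the trace of `d` from the complement of `F`,
on `(F ∩ ∂Ω) \ Γ` it vanishes. -/
structure IsCahnHoffman (L : ℝ) (Γ : Set ℝ) (p q : ℝ) (d : ℝ → ℝ)
    (z w : ℝ → ℝ) (n : Fin 2 → ℝ) : Prop where
  meas : AEStronglyMeasurable z (volume.restrict (Icc p q))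
  bound : ∀ᵐ x ∂volume.restrict (Icc p q), |z x| ≤ 1
  div_memLp : MemLp w 2 (volume.restrict (Icc p q))
  green : ∀ φ : ℝ → ℝ, ContDiff ℝ 1 φ →
    (∫ x in Icc p q, w x * φ x) + (∫ x in Icc p q, z x * deriv φ x) = n 0 * φ p + n 1 * φ q
  inner_left : p ∈ Ioo 0 L → Tendsto d (𝓝[<] p) (𝓝 (n 0))
  inner_right : q ∈ Ioo 0 L → Tendsto d (𝓝[>] q) (𝓝 (n 1))
  neumann_left : p ∈ ({0, L} : Set ℝ) \ Γ → n 0 = 0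
  neumann_right : q ∈ ({0, L} : Set ℝ) \ Γ → n 1 = 0

open Classical in
/-- The end points of `F = [p, q]` belonging to `Γ_F = ∂F ∩ Γ` (as indices, `0 ↦ p`, `1 ↦ q`). -/
def gammaF (Γ : Set ℝ) (p q : ℝ) : Finset (Fin 2) :=
  Finset.univ.filter fun i => (![p, q] : Fin 2 → ℝ) i ∈ Γ

/-- `I_τ(z) = ∫_F |div z|² dx + (1/τ) ∑_{Γ_F} [z·ν]²`, with `w = div z` and `n = [z·ν]`. -/
def facetEnergy (τ : ℝ) (Γ : Set ℝ) (p q : ℝ) (w : ℝ → ℝ) (n : Fin 2 → ℝ) : ℝ :=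
  (∫ x in Icc p q, w x ^ 2) + τ⁻¹ * ∑ i ∈ gammaF Γ p q, n i ^ 2

/-- `z` is a Cahn–Hoffman field minimizing `I_τ` over all Cahn–Hoffman fields of the facet. -/
def IsMinimalCahnHoffman (τ L : ℝ) (Γ : Set ℝ) (p q : ℝ) (d : ℝ → ℝ)
    (z w : ℝ → ℝ) (n : Fin 2 → ℝ) : Prop :=
  IsCahnHoffman L Γ p q d z w n ∧
  ∀ z' w' n', IsCahnHoffman L Γ p q d z' w' n' →
    facetEnergy τ Γ p q w n ≤ facetEnergy τ Γ p q w' n'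

/-- The facet `([p, q], d)` is calibrable: some minimizer of `I_τ` has constant divergence
in `F` and constant normal trace on `Γ_F`. -/
def IsCalibrable (τ L : ℝ) (Γ : Set ℝ) (p q : ℝ) (d : ℝ → ℝ) : Prop :=
  IsFacet L p q d ∧ ∃ z w n, IsMinimalCahnHoffman τ L Γ p q d z w n ∧
    (∃ c, ∀ᵐ x ∂volume.restrict (Icc p q), w x = c) ∧ (∃ c, ∀ i ∈ gammaF Γ p q, n i = c)

/-- The facet `([p, q], d)` is `(τ, Γ)`-coherent: `τ λ_z + μ_z = 0` for some minimizer `z` of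
`I_τ`, where `λ_z`, `μ_z` are the means of `div z` over `F` and of `[z·ν]` over `Γ_F`. -/
def IsCoherent (τ L : ℝ) (Γ : Set ℝ) (p q : ℝ) (d : ℝ → ℝ) : Prop :=
  IsFacet L p q d ∧ ∃ z w n, IsMinimalCahnHoffman τ L Γ p q d z w n ∧
    τ * ((q - p)⁻¹ * ∫ x in Icc p q, w x) +
      ((gammaF Γ p q).card : ℝ)⁻¹ * ∑ i ∈ gammaF Γ p q, n i = 0

/-- The profile `c₁` on `[0, a]`, `f` on `(a, b)`, `c₂` on `[b, L]`. -/
def threePiece (a b c₁ c₂ : ℝ) (f : ℝ → ℝ) (x : ℝ) : ℝ :=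
  if x ≤ a then c₁ else if x < b then f x else c₂

end TVFlow

end

noncomputable section

namespace TVFlow

/-! ### Gradient flows in a Hilbert space: uniqueness and a verification criterion. -/

section Abstract

variable {X : Type*} [NormedAddCommGroup X] [InnerProductSpace ℝ X]

theorem subdifferential_monotone {Φ : X → ℝ≥0∞} {w₁ w₂ η₁ η₂ : X}
    (h₁ : η₁ ∈ subdifferential Φ w₁) (h₂ : η₂ ∈ subdifferential Φ w₂) :
    0 ≤ ⟪η₁ - η₂, w₁ - w₂⟫_ℝ := by
  have h := h₁.2 w₂ h₂.1
  have h' := h₂.2 w₁ h₁.1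
  rw [← neg_sub w₁ w₂, inner_neg_right] at h
  rw [inner_sub_left]
  linarith

/-- The squared norm of the primitive w of f is absolutely continuous, starts at 0, and has
derivative 2⟪w, f⟫ ≤ 0 almost everywhere. Absolute continuity of the vector-valued w is inherited
from the real primitive of ‖f‖, which dominates its increments. -/
theorem norm_integral_sq_le_of_inner_nonpos [CompleteSpace X] {f : ℝ → X} {t : ℝ} (ht : 0 ≤ t)
    (hf : IntervalIntegrable f volume 0 t)
    (h : ∀ᵐ s, s ∈ Ioc 0 t → ⟪∫ r in (0 : ℝ)..s, f r, f s⟫_ℝ ≤ 0) :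
    ‖∫ r in (0 : ℝ)..t, f r‖ ^ 2 ≤ 0 := by
  set w : ℝ → X := fun s => ∫ r in (0 : ℝ)..s, f r with hw
  have hsub : ∀ s ∈ uIcc 0 t, IntervalIntegrable f volume 0 s := fun s hs =>
    hf.mono_set (uIcc_subset_uIcc left_mem_uIcc hs)
  have hwΦ : ∀ x ∈ uIcc 0 t, ∀ y ∈ uIcc 0 t,
      ‖w x - w y‖ ≤ dist (∫ r in (0 : ℝ)..x, ‖f r‖) (∫ r in (0 : ℝ)..y, ‖f r‖) := by
    intro x hx y hy
    rw [hw, Real.dist_eq, intervalIntegral.integral_interval_sub_left (hsub x hx) (hsub y hy),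
      intervalIntegral.integral_interval_sub_left (hsub x hx).norm (hsub y hy).norm]
    exact intervalIntegral.norm_integral_le_abs_integral_norm
  have hΦ : AbsolutelyContinuousOnInterval (fun s => ∫ r in (0 : ℝ)..s, ‖f r‖) 0 t :=
    hf.norm.absolutelyContinuousOnInterval_intervalIntegral left_mem_uIcc
  have hwAC : AbsolutelyContinuousOnInterval w 0 t := by
    refine squeeze_zero' (Eventually.of_forall fun E => Finset.sum_nonneg fun i _ => dist_nonneg)
      ?_ hΦ
    refine eventually_inf_principal.2 (Eventually.of_forall fun E hE => ?_)
    refine Finset.sum_le_sum fun i hi => ?_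
    rw [dist_eq_norm]
    exact hwΦ _ (hE.1 i hi).1 _ (hE.1 i hi).2
  have hAC : AbsolutelyContinuousOnInterval (fun s => ‖w s‖ ^ 2) 0 t := by
    obtain ⟨C, hC⟩ := hwAC.exists_bound
    refine squeeze_zero' (Eventually.of_forall fun E => Finset.sum_nonneg fun i _ => dist_nonneg)
      ?_ (by simpa using Tendsto.const_mul (2 * C) hwAC)
    refine eventually_inf_principal.2 (Eventually.of_forall fun E hE => ?_)
    rw [Finset.mul_sum]
    refine Finset.sum_le_sum fun i hi => ?_
    have hx := hC _ (hE.1 i hi).1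
    have hy := hC _ (hE.1 i hi).2
    set p := w (E.2 i).1
    set q := w (E.2 i).2
    rw [Real.dist_eq, dist_eq_norm, sq_sub_sq, abs_mul,
      abs_of_nonneg (add_nonneg (norm_nonneg p) (norm_nonneg q))]
    exact mul_le_mul (by linarith) (abs_norm_sub_norm_le p q) (abs_nonneg _)
      (by linarith [norm_nonneg p])
  have hint := hAC.integral_deriv_eq_sub
  have hw0 : w 0 = 0 := by simp [hw]
  have hle : ∫ s in (0 : ℝ)..t, deriv (fun s => ‖w s‖ ^ 2) s ≤ 0 := by
    rw [intervalIntegral.integral_of_le ht]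
    refine integral_nonpos_of_ae ?_
    have hd := hf.ae_hasDerivAt_integral
    filter_upwards [ae_restrict_of_ae hd, ae_restrict_of_ae h,
      ae_restrict_mem measurableSet_Ioc] with s h1 h2 hs
    have hs' : s ∈ uIcc 0 t := by rw [uIcc_of_le ht]; exact ⟨hs.1.le, hs.2⟩
    have := (h1 hs' 0 left_mem_uIcc).norm_sq
    rw [this.deriv]
    have := h2 hs
    simp only [Pi.zero_apply]
    linarith
  simp only [hw0, norm_zero] at hint
  linarith

theorem IsGradientFlow.unique [CompleteSpace X] {Φ : X → ℝ≥0∞} {w₀ : X} {w₁ w₂ : ℝ → X}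
    (h₁ : IsGradientFlow Φ w₀ w₁) (h₂ : IsGradientFlow Φ w₀ w₂) {t : ℝ} (ht : 0 ≤ t) :
    w₁ t = w₂ t := by
  obtain ⟨g₁, m₁, e₁, s₁⟩ := h₁
  obtain ⟨g₂, m₂, e₂, s₂⟩ := h₂
  have hint : ∀ {g : ℝ → X} {s : ℝ}, (∀ T : ℝ, MemLp g 2 (volume.restrict (Ioc 0 T))) →
      0 ≤ s → IntervalIntegrable g volume 0 s := fun {g s} hg hs =>
    (intervalIntegrable_iff_integrableOn_Ioc_of_le hs).2 ((hg s).integrable (by norm_num))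
  have hdiff : ∀ s, 0 ≤ s → ∫ r in (0 : ℝ)..s, (g₁ r - g₂ r) = w₁ s - w₂ s := by
    intro s hs
    rw [intervalIntegral.integral_sub (hint m₁ hs) (hint m₂ hs), e₁ s hs, e₂ s hs]
    abel
  have key := norm_integral_sq_le_of_inner_nonpos ht ((hint m₁ ht).sub (hint m₂ ht)) (by
    rw [ae_restrict_iff' measurableSet_Ioi] at s₁ s₂
    filter_upwards [s₁, s₂] with s h1 h2 hs
    have := subdifferential_monotone (h1 hs.1) (h2 hs.1)
    rw [hdiff s hs.1.le, real_inner_comm]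
    rw [neg_sub_neg, ← neg_sub (g₁ s), inner_neg_left] at this
    linarith)
  rw [hdiff t ht] at key
  have : ‖w₁ t - w₂ t‖ = 0 := by
    have := sq_nonneg ‖w₁ t - w₂ t‖
    exact pow_eq_zero_iff two_ne_zero |>.1 (le_antisymm key this)
  exact sub_eq_zero.1 (norm_eq_zero.1 this)

theorem _root_.LipschitzWith.norm_derivWithin_Ici_le {w : ℝ → X} {C : ℝ≥0}
    (hlip : LipschitzWith C w) (t : ℝ) : ‖derivWithin w (Ici t) t‖ ≤ C := by
  by_cases hd : DifferentiableWithinAt ℝ w (Ici t) t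
  · have h := hasDerivWithinAt_iff_tendsto_slope.1 hd.hasDerivWithinAt
    rw [Ici_sdiff_left] at h
    refine le_of_tendsto h.norm ?_
    filter_upwards [self_mem_nhdsWithin] with s hs
    have hs' : 0 < |s - t| := abs_pos.2 (sub_ne_zero.2 (ne_of_gt hs))
    rw [slope_def_module, norm_smul, norm_inv, Real.norm_eq_abs, inv_mul_le_iff₀ hs', mul_comm,
      ← Real.dist_eq, ← dist_eq_norm]
    exact hlip.dist_le_mul s t
  · rw [derivWithin_zero_of_not_differentiableWithinAt hd, norm_zero]
    exact C.coe_nonneg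

/-- Right derivatives are all that is required, so a velocity that jumps when the facets meet causes
no trouble. The right derivative is measurable and bounded by the Lipschitz constant, and the
fundamental theorem of calculus for right derivatives recovers w from it. -/
theorem isGradientFlow_of_hasDerivWithinAt [CompleteSpace X] {Φ : X → ℝ≥0∞} {w : ℝ → X}
    {C : ℝ≥0} (hlip : LipschitzWith C w)
    (h : ∀ t, 0 < t → ∃ W, HasDerivWithinAt w W (Ici t) t ∧ -W ∈ subdifferential Φ (w t)) :
    IsGradientFlow Φ (w 0) w := by
  have hb : ∀ t, ‖derivWithin w (Ici t) t‖ ≤ C := fun t =>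
    hlip.norm_derivWithin_Ici_le t
  have hd : ∀ t, 0 < t → HasDerivWithinAt w (derivWithin w (Ici t) t) (Ici t) t := fun t ht => by
    obtain ⟨W, hW, -⟩ := h t ht
    exact hW.differentiableWithinAt.hasDerivWithinAt
  refine ⟨fun t => derivWithin w (Ici t) t, fun T => ?_, fun t ht => ?_, ?_⟩
  · exact MemLp.of_bound (aestronglyMeasurable_derivWithin_Ici w _) C
      (Eventually.of_forall hb)
  · have : IntervalIntegrable (fun t => derivWithin w (Ici t) t) volume 0 t :=
      (intervalIntegrable_iff_integrableOn_Ioc_of_le ht).2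
        (Integrable.of_bound (aestronglyMeasurable_derivWithin_Ici w _) C
          (Eventually.of_forall hb))
    rw [intervalIntegral.integral_eq_sub_of_hasDeriv_right_of_le ht hlip.continuous.continuousOn
      (fun x hx => (hd x hx.1).mono Ioi_subset_Ici_self) this]
    abel
  · refine (ae_restrict_mem measurableSet_Ioi).mono fun t ht => ?_
    obtain ⟨W, hW, hW'⟩ := h t ht
    simpa only [hW.derivWithin (uniqueDiffWithinAt_Ici t)] using hW'

end Abstract

/-! ### A scalar autonomous equation -/

/-- Separation of variables: h is the inverse of G(s) = ∫ k from c to s. Only continuity of k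
enters, which matters because the inverse of a Lipschitz profile need not be Lipschitz. The bound k
≥ 1 makes G(s) - s monotone, so G is onto and h is global. -/
theorem exists_autonomous_ode_solution {k : ℝ → ℝ} (hk : Continuous k) (hk1 : ∀ s, 1 ≤ k s)
    (c : ℝ) : ∃ h : ℝ → ℝ, h 0 = c ∧ StrictMono h ∧ Function.Surjective h ∧
      ∀ t, HasDerivAt h (1 / k (h t)) t := by
  set G : ℝ → ℝ := fun s => ∫ r in c..s, k r with hG
  have hGd : ∀ s, HasDerivAt G (k s) s := fun s =>
    intervalIntegral.integral_hasDerivAt_right (hk.intervalIntegrable _ _)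
      (hk.stronglyMeasurableAtFilter _ _) hk.continuousAt
  have hGc : Continuous G := continuous_iff_continuousAt.2 fun s => (hGd s).continuousAt
  have hGm : StrictMono G := strictMono_of_deriv_pos fun s => by
    rw [(hGd s).deriv]; linarith [hk1 s]
  have hG0 : G c = 0 := by simp [hG]
  have hmono : Monotone fun s => G s - s := by
    refine monotone_of_deriv_nonneg
      (fun s => ((hGd s).sub (hasDerivAt_id s)).differentiableAt) fun s => ?_
    have : deriv (fun s => G s - s) s = k s - 1 := ((hGd s).sub (hasDerivAt_id s)).deriv
    rw [this]; linarith [hk1 s]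
  have hGs : Function.Surjective G := by
    refine hGc.surjective ?_ ?_
    · refine tendsto_atTop_mono' _ ((eventually_ge_atTop c).mono fun s hs => ?_)
        (tendsto_atTop_add_const_right atTop (-c) tendsto_id)
      have := hmono hs
      simp only [id, hG0] at *; linarith
    · refine tendsto_atBot_mono' _ ((eventually_le_atBot c).mono fun s hs => ?_)
        (tendsto_atBot_add_const_right atBot (-c) tendsto_id)
      have := hmono hs
      simp only [id, hG0] at *; linarith
  set e := hGm.orderIsoOfSurjective G hGs with he
  have hGe : ∀ t, G (e.symm t) = t := fun t => e.apply_symm_apply t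
  refine ⟨e.symm, ?_, e.symm.strictMono, e.symm.surjective, fun t => ?_⟩
  · rw [e.symm_apply_eq, ← hG0]; rfl
  · rw [one_div]
    exact HasDerivAt.of_local_left_inverse e.symm.continuous.continuousAt (hGd _)
      (by linarith [hk1 (e.symm t)]) (Eventually.of_forall hGe)

/-! ### Testing the total variation with Lipschitz functions -/

theorem totalVar_test_le {L : ℝ} {u φ : ℝ → ℝ} (hφ : ContDiff ℝ 1 φ) (hc : HasCompactSupport φ)
    (hs : tsupport φ ⊆ Ioo 0 L) (h1 : ∀ x, |φ x| ≤ 1) :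
    ENNReal.ofReal (∫ x in Ioo 0 L, u x * deriv φ x) ≤ totalVar L u :=
  le_iSup₂_of_le (f := fun φ (_ : φ ∈ {φ : ℝ → ℝ | ContDiff ℝ 1 φ ∧ HasCompactSupport φ ∧
      tsupport φ ⊆ Ioo 0 L ∧ ∀ x, |φ x| ≤ 1}) =>
    ENNReal.ofReal (∫ x in Ioo 0 L, u x * deriv φ x)) φ ⟨hφ, hc, hs, h1⟩ le_rfl

theorem totalVar_congr {L : ℝ} {u v : ℝ → ℝ} (h : u =ᵐ[volume.restrict (Ioo 0 L)] v) :
    totalVar L u = totalVar L v := by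
  unfold totalVar
  refine iSup_congr fun φ => iSup_congr fun _ => congrArg ENNReal.ofReal ?_
  exact integral_congr_ae (h.mono fun x hx => by simp only [hx])

/-- Squeezing the argument into the interior: the affine map taking `[2ε, L - 2ε]` to `[0, L]`. -/
def squeeze (L ε x : ℝ) : ℝ := L * (x - 2 * ε) / (L - 4 * ε)

theorem hasDerivAt_squeeze_shift {L : ℝ} (hL : 0 < L) (x c : ℝ) :
    HasDerivAt (fun ε => squeeze L ε (x + c * ε)) ((4 * x + (c - 2) * L) / L) 0 := by
  have h1 : HasDerivAt (fun ε : ℝ => L * (x + c * ε - 2 * ε)) (L * (c - 2)) 0 := by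
    have := ((((hasDerivAt_id (0 : ℝ)).const_mul c).const_add x).sub
      ((hasDerivAt_id (0 : ℝ)).const_mul 2)).const_mul L
    simpa using this
  have h2 : HasDerivAt (fun ε : ℝ => L - 4 * ε) (-4) 0 := by
    simpa using ((hasDerivAt_id (0 : ℝ)).const_mul 4).const_sub L
  have := h1.div h2 (by simp [hL.ne'])
  refine this.congr_deriv ?_
  have := hL.ne'
  simp only [mul_zero, add_zero, sub_zero]
  field_simp
  ring

/-- The squeezing moves both arguments by the same first-order amount, so this drift cancels in the
difference and only the separation 2ε survives. What remains is a central difference quotient. -/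
theorem tendsto_squeezed_difference_quotient {L : ℝ} (hL : 0 < L) {ψ : ℝ → ℝ} {x : ℝ}
    (hx : DifferentiableAt ℝ ψ x) :
    Tendsto (fun ε => (2 * ε)⁻¹ * (ψ (squeeze L ε (x + ε)) - ψ (squeeze L ε (x - ε))))
      (𝓝[>] 0) (𝓝 (deriv ψ x)) := by
  have h0 : ∀ c : ℝ, squeeze L 0 (x + c * 0) = x := fun c => by
    simp only [squeeze, mul_zero, add_zero, sub_zero]; exact mul_div_cancel_left₀ x hL.ne'
  have hd : ∀ c : ℝ, HasDerivAt (fun ε => ψ (squeeze L ε (x + c * ε)))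
      (deriv ψ x * ((4 * x + (c - 2) * L) / L)) 0 := fun c =>
    HasDerivAt.comp (h₂ := ψ) 0 (by rw [h0]; exact hx.hasDerivAt) (hasDerivAt_squeeze_shift hL x c)
  have h := (hd 1).sub (hd (-1))
  have h' := (hasDerivAt_iff_tendsto_slope.1 h).mono_left
    (nhdsWithin_mono (0 : ℝ) (fun y (hy : y ∈ Ioi (0 : ℝ)) => ne_of_gt hy))
  have h'' := h'.const_mul (2⁻¹ : ℝ)
  refine (h''.congr fun ε => ?_).trans (le_of_eq ?_)
  · simp only [slope_def_field, Pi.sub_apply, h0, sub_self, sub_zero, mul_inv]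
    simp only [one_mul, neg_mul, ← sub_eq_add_neg]
    ring
  · congr 1
    field_simp
    ring

/-- φ is the average of ψ ∘ `squeeze` over [x - ε, x + ε]. Averaging makes it C¹ and preserves the
bound 1; the squeezing makes ψ vanish off (2ε, L - 2ε), so the average is still supported inside (0,
L). -/
theorem exists_test_squeeze {L ε : ℝ} (hε : 0 < ε) (hεL : 8 * ε < L) {ψ : ℝ → ℝ}
    (hψ : Continuous ψ) (h0 : ∀ x, x ∉ Ioo 0 L → ψ x = 0) (h1 : ∀ x, |ψ x| ≤ 1) :
    ∃ φ : ℝ → ℝ, ContDiff ℝ 1 φ ∧ HasCompactSupport φ ∧ tsupport φ ⊆ Ioo 0 L ∧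
      (∀ x, |φ x| ≤ 1) ∧
      ∀ x, deriv φ x = (2 * ε)⁻¹ * (ψ (squeeze L ε (x + ε)) - ψ (squeeze L ε (x - ε))) := by
  have hsc : Continuous (squeeze L ε) := by unfold squeeze; fun_prop
  set θ : ℝ → ℝ := fun x => ψ (squeeze L ε x) with hθ
  have hθc : Continuous θ := hψ.comp hsc
  have hθ0 : ∀ x, x ∉ Ioo (2 * ε) (L - 2 * ε) → θ x = 0 := fun x hx => by
    refine h0 _ fun hmem => hx ?_
    have hden : 0 < L - 4 * ε := by linarith
    have h1 := hmem.1
    have h2 := hmem.2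
    unfold squeeze at h1 h2
    rw [lt_div_iff₀ hden] at h1
    rw [div_lt_iff₀ hden] at h2
    constructor <;> nlinarith
  set Θ : ℝ → ℝ := fun x => ∫ y in (0 : ℝ)..x, θ y with hΘ
  have hΘd : ∀ x, HasDerivAt Θ (θ x) x := fun x =>
    intervalIntegral.integral_hasDerivAt_right (hθc.intervalIntegrable _ _)
      (hθc.stronglyMeasurableAtFilter _ _) hθc.continuousAt
  have hΘsub : ∀ x y, Θ y - Θ x = ∫ s in x..y, θ s := fun x y =>
    intervalIntegral.integral_interval_sub_left (hθc.intervalIntegrable _ _)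
      (hθc.intervalIntegrable _ _)
  set φ : ℝ → ℝ := fun x => (2 * ε)⁻¹ * (Θ (x + ε) - Θ (x - ε)) with hφ
  have hφd : ∀ x, HasDerivAt φ ((2 * ε)⁻¹ * (θ (x + ε) - θ (x - ε))) x := fun x =>
    (((hΘd (x + ε)).comp_add_const x ε).sub ((hΘd (x - ε)).comp_sub_const x ε)).const_mul _
  have hderiv : deriv φ = fun x => (2 * ε)⁻¹ * (θ (x + ε) - θ (x - ε)) :=
    funext fun x => (hφd x).deriv
  have hφ0 : ∀ x, x ∉ Icc ε (L - ε) → φ x = 0 := fun x hx => by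
    have : ∫ s in (x - ε)..(x + ε), θ s = 0 := by
      refine intervalIntegral.integral_zero_ae (Eventually.of_forall fun s hs => hθ0 s fun hs' => ?_)
      rw [uIoc_of_le (by linarith)] at hs
      exact hx ⟨by linarith [hs.2, hs'.1], by linarith [hs.1, hs'.2]⟩
    simp only [hφ, hΘsub, this, mul_zero]
  have hsupp : tsupport φ ⊆ Icc ε (L - ε) :=
    closure_minimal (fun x hx => by_contra fun h => hx (hφ0 x h)) isClosed_Icc
  refine ⟨φ, contDiff_one_iff_deriv.2 ⟨fun x => (hφd x).differentiableAt, ?_⟩,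
    HasCompactSupport.of_support_subset_isCompact isCompact_Icc
      ((subset_tsupport _).trans hsupp), hsupp.trans fun x hx =>
      ⟨hε.trans_le hx.1, by linarith [hx.2]⟩, fun x => ?_, fun x => by rw [hderiv]⟩
  · rw [hderiv]; fun_prop
  · have : ‖∫ s in (x - ε)..(x + ε), θ s‖ ≤ 1 * |x + ε - (x - ε)| :=
      intervalIntegral.norm_integral_le_of_norm_le_const fun s _ => h1 _
    rw [show x + ε - (x - ε) = 2 * ε by ring, abs_of_pos (by linarith : (0 : ℝ) < 2 * ε),
      Real.norm_eq_abs] at this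
    simp only [hφ, hΘsub, abs_mul]
    rw [abs_of_pos (by positivity), inv_mul_le_iff₀ (by positivity)]
    linarith

/-- The approximations of `exists_test_squeeze` are admissible, and by Rademacher their derivatives
converge to ψ' almost everywhere. Dominated convergence then transfers the bound. -/
theorem integral_mul_deriv_le_totalVar {L : ℝ} (hL : 0 < L) {u ψ : ℝ → ℝ} {K : ℝ≥0}
    (hu : IntegrableOn u (Ioo 0 L)) (hψ : LipschitzWith K ψ)
    (h0 : ∀ x, x ∉ Ioo 0 L → ψ x = 0) (h1 : ∀ x, |ψ x| ≤ 1) (hfin : totalVar L u < ∞) :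
    ∫ x in Ioo 0 L, u x * deriv ψ x ≤ (totalVar L u).toReal := by
  have hlim : Tendsto (fun ε => ∫ x in Ioo 0 L, u x *
      ((2 * ε)⁻¹ * (ψ (squeeze L ε (x + ε)) - ψ (squeeze L ε (x - ε)))))
      (𝓝[>] 0) (𝓝 (∫ x in Ioo 0 L, u x * deriv ψ x)) := by
    have hsmall : ∀ᶠ ε in 𝓝[>] (0 : ℝ), 0 < ε ∧ 8 * ε < L := by
      filter_upwards [Ioo_mem_nhdsGT (show (0 : ℝ) < L / 8 by linarith)] with ε hε
      exact ⟨hε.1, by linarith [hε.2]⟩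
    refine tendsto_integral_filter_of_dominated_convergence (fun x => ‖u x‖ * (2 * K))
      ?_ ?_ (hu.norm.mul_const _) ?_
    · refine Eventually.of_forall fun ε => hu.aestronglyMeasurable.mul ?_
      have := hψ.continuous
      refine Continuous.aestronglyMeasurable ?_
      unfold squeeze; fun_prop
    · filter_upwards [hsmall] with ε hε
      refine Eventually.of_forall fun x => ?_
      rw [norm_mul]
      refine mul_le_mul_of_nonneg_left ?_ (norm_nonneg _)
      have h2 := hψ.dist_le_mul (squeeze L ε (x + ε)) (squeeze L ε (x - ε))
      have hden : 0 < L - 4 * ε := by linarith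
      have h3 : squeeze L ε (x + ε) - squeeze L ε (x - ε) = 2 * ε * (L / (L - 4 * ε)) := by
        unfold squeeze; field_simp; ring
      -- The squeezing stretches lengths by this factor; 8ε < L keeps it below 2, hence the
      -- dominating constant 2K.
      have h4 : L / (L - 4 * ε) ≤ 2 := by rw [div_le_iff₀ hden]; linarith
      have h5 : 0 ≤ L / (L - 4 * ε) := by positivity
      have hε' := hε.1
      rw [Real.dist_eq, Real.dist_eq, h3, abs_of_nonneg (a := 2 * ε * _) (by positivity)] at h2
      rw [norm_mul, norm_inv, Real.norm_of_nonneg (by positivity : 0 ≤ 2 * ε), Real.norm_eq_abs,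
        inv_mul_le_iff₀ (by positivity)]
      calc _ ≤ _ := h2
        _ = 2 * ε * (L / (L - 4 * ε) * K) := by ring
        _ ≤ 2 * ε * (2 * K) := by gcongr
    · filter_upwards [ae_restrict_of_ae hψ.ae_differentiableAt] with x hx
      exact (tendsto_squeezed_difference_quotient hL hx).const_mul _
  refine le_of_tendsto hlim ?_
  filter_upwards [Ioo_mem_nhdsGT (show (0 : ℝ) < L / 8 by linarith)] with ε hε
  obtain ⟨φ, hφ1, hφ2, hφ3, hφ4, hφ5⟩ :=
    exists_test_squeeze hε.1 (by linarith [hε.2]) hψ.continuous h0 h1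
  have := totalVar_test_le (u := u) hφ1 hφ2 hφ3 hφ4
  simp only [hφ5] at this
  exact (ENNReal.ofReal_le_iff_le_toReal hfin.ne).1 this

/-! ### Boundary means and existence of traces -/

/-- The part of `(0, L)` within distance `r` of the `i`-th end point. -/
def endSet (L : ℝ) (i : Fin 2) (r : ℝ) : Set ℝ := if i = 0 then Ioo 0 r else Ioo (L - r) L

theorem endMean_eq (L : ℝ) (u : ℝ → ℝ) (i : Fin 2) (r : ℝ) :
    endMean L u i r = r⁻¹ * ∫ x in endSet L i r, u x := rfl

theorem measurableSet_endSet (L : ℝ) (i : Fin 2) (r : ℝ) : MeasurableSet (endSet L i r) := by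
  unfold endSet; split_ifs <;> exact measurableSet_Ioo

theorem endSet_subset {L r : ℝ} (i : Fin 2) (hr : r ≤ L) : endSet L i r ⊆ Ioo 0 L := by
  unfold endSet
  split_ifs
  · exact Ioo_subset_Ioo_right hr
  · exact Ioo_subset_Ioo_left (by linarith)

theorem volume_endSet (L : ℝ) (i : Fin 2) (r : ℝ) : volume (endSet L i r) = ENNReal.ofReal r := by
  unfold endSet
  split_ifs <;> simp

theorem abs_sub_endpt_lt {L r x : ℝ} {i : Fin 2} (hx : x ∈ endSet L i r) :
    |x - endpt L i| < r := by
  rw [abs_lt]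
  fin_cases i
  · simp [endSet, endpt] at hx ⊢
    constructor <;> linarith
  · simp [endSet, endpt] at hx ⊢
    constructor <;> linarith

theorem integral_endSet_const (L c : ℝ) (i : Fin 2) {r : ℝ} (hr : 0 ≤ r) :
    ∫ _ in endSet L i r, c = r * c := by
  rw [setIntegral_const, measureReal_def, volume_endSet, ENNReal.toReal_ofReal hr, smul_eq_mul]

theorem eventually_small {L : ℝ} (hL : 0 < L) : ∀ᶠ r in 𝓝[>] (0 : ℝ), 0 < r ∧ r < L :=
  Ioo_mem_nhdsGT hL

theorem tendsto_integral_endSet {L : ℝ} (hL : 0 < L) {u : ℝ → ℝ} (hu : IntegrableOn u (Ioo 0 L))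
    (i : Fin 2) : Tendsto (fun r => ∫ x in endSet L i r, u x) (𝓝[>] 0) (𝓝 0) := by
  have h : Tendsto (fun r => ∫ x in endSet L i r, u x ∂(volume.restrict (Ioo 0 L)))
      (𝓝[>] 0) (𝓝 0) := by
    refine hu.tendsto_setIntegral_nhds_zero ?_
    refine tendsto_of_tendsto_of_tendsto_of_le_of_le tendsto_const_nhds
      (h := fun r => ENNReal.ofReal r) ?_ (fun _ => zero_le) fun r => ?_
    · have : Tendsto ENNReal.ofReal (𝓝 0) (𝓝 (ENNReal.ofReal 0)) :=
        ENNReal.continuous_ofReal.tendsto 0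
      rw [ENNReal.ofReal_zero] at this
      exact this.mono_left nhdsWithin_le_nhds
    · exact (Measure.restrict_apply_le _ _).trans (volume_endSet L i r).le
  refine h.congr' ((eventually_small hL).mono fun r hr => ?_)
  rw [Measure.restrict_restrict_of_subset (endSet_subset i hr.2.le)]

theorem hasTrace_congr {L : ℝ} (hL : 0 < L) {u v : ℝ → ℝ}
    (h : u =ᵐ[volume.restrict (Ioo 0 L)] v) {i : Fin 2} {c : ℝ} (hv : HasTrace L v i c) :
    HasTrace L u i c := by
  refine Tendsto.congr' ((eventually_small hL).mono fun r hr => ?_) hv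
  rw [endMean_eq, endMean_eq]
  congr 1
  refine integral_congr_ae ?_
  have := ae_restrict_of_ae_restrict_of_subset (endSet_subset i hr.2.le) h
  exact this.mono fun x hx => hx.symm

/-- Within distance r of the end point, z differs from its end value by at most K r. The factor r
cancels the r⁻¹ of the mean, leaving an error K ∫ |u| over a shrinking set. -/
theorem HasTrace.mul_lipschitz {L : ℝ} (hL : 0 < L) {u z : ℝ → ℝ} (hu : IntegrableOn u (Ioo 0 L))
    {K : ℝ≥0} (hz : LipschitzWith K z) {i : Fin 2} {c : ℝ} (h : HasTrace L u i c) :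
    HasTrace L (fun x => u x * z x) i (c * z (endpt L i)) := by
  set p := endpt L i
  have hu' : ∀ {r}, r < L → IntegrableOn u (endSet L i r) := fun hr =>
    hu.mono_set (endSet_subset i hr.le)
  have hdiff : Tendsto (fun r => r⁻¹ * ∫ x in endSet L i r, u x * (z x - z p)) (𝓝[>] 0) (𝓝 0) := by
    have h0 := (tendsto_integral_endSet hL hu.norm i).mul_const (K : ℝ)
    rw [zero_mul] at h0
    refine squeeze_zero_norm' ((eventually_small hL).mono fun r hr => ?_) h0
    have hle : ‖∫ x in endSet L i r, u x * (z x - z p)‖ ≤ ∫ x in endSet L i r, ‖u x‖ * (K * r) := by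
      refine norm_integral_le_of_norm_le ((hu' hr.2).norm.mul_const _) ?_
      filter_upwards [ae_restrict_mem (measurableSet_endSet L i r)] with x hx
      rw [norm_mul]
      refine mul_le_mul_of_nonneg_left ?_ (norm_nonneg _)
      rw [← dist_eq_norm]
      refine (hz.dist_le_mul x p).trans ?_
      rw [Real.dist_eq]
      gcongr
      exact (abs_sub_endpt_lt hx).le
    rw [norm_mul, norm_inv, Real.norm_of_nonneg hr.1.le, inv_mul_le_iff₀ hr.1]
    rw [integral_mul_const] at hle
    linarith
  have hsum := (h.mul_const (z p)).add hdiff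
  rw [add_zero] at hsum
  refine hsum.congr' ((eventually_small hL).mono fun r hr => ?_)
  have hi := hu' hr.2
  have hi2 : IntegrableOn (fun x => u x * (z x - z p)) (endSet L i r) := by
    refine Integrable.mul_bdd (c := K * r) hi
      (hz.continuous.sub continuous_const).aestronglyMeasurable ?_
    filter_upwards [ae_restrict_mem (measurableSet_endSet L i r)] with x hx
    rw [← dist_eq_norm]
    refine (hz.dist_le_mul x p).trans ?_
    rw [Real.dist_eq]
    gcongr
    exact (abs_sub_endpt_lt hx).le
  rw [endMean_eq, endMean_eq, mul_assoc, ← mul_add, ← integral_mul_const,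
    ← integral_add (hi.mul_const _) hi2]
  congr 1
  refine integral_congr_ae (Eventually.of_forall fun x => ?_)
  simp only; ring

theorem hasTrace_of_tendsto {L : ℝ} (hL : 0 < L) {u : ℝ → ℝ} (hu : IntegrableOn u (Ioo 0 L))
    {i : Fin 2} {c : ℝ} (h : Tendsto u (𝓝[Ioo 0 L] (endpt L i)) (𝓝 c)) : HasTrace L u i c := by
  rw [HasTrace, Metric.tendsto_nhds]
  intro ε hε
  obtain ⟨δ, hδ, hδu⟩ := Metric.mem_nhdsWithin_iff.1
    (h.eventually (Metric.closedBall_mem_nhds c (half_pos hε)))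
  filter_upwards [eventually_small hL, eventually_small hδ] with r hr hrδ
  have hi := hu.mono_set (endSet_subset i hr.2.le)
  have hlt : volume (endSet L i r) < ∞ := by rw [volume_endSet]; exact ENNReal.ofReal_lt_top
  have hle : ‖∫ x in endSet L i r, (u x - c)‖ ≤ ε / 2 * (volume.real (endSet L i r)) := by
    refine norm_setIntegral_le_of_norm_le_const hlt fun x hx => ?_
    have := hδu ⟨?_, endSet_subset i hr.2.le hx⟩
    · rwa [← dist_eq_norm]
    · rw [Metric.mem_ball, Real.dist_eq]
      exact (abs_sub_endpt_lt hx).trans hrδ.2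
  rw [integral_sub hi (integrableOn_const hlt.ne), integral_endSet_const L c i hr.1.le,
    measureReal_def, volume_endSet, ENNReal.toReal_ofReal hr.1.le] at hle
  have : endMean L u i r - c = r⁻¹ * ((∫ x in endSet L i r, u x) - r * c) := by
    rw [endMean_eq, mul_sub, inv_mul_cancel_left₀ hr.1.ne']
  rw [dist_eq_norm, this, norm_mul, norm_inv, Real.norm_of_nonneg hr.1.le, inv_mul_lt_iff₀ hr.1]
  nlinarith [hr.1]

/-- Reflection sends a test function φ to -φ(L - ·). It lets the right end point be treated through
the left one. -/
theorem totalVar_reflect_le (L : ℝ) (u : ℝ → ℝ) :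
    totalVar L (fun x => u (L - x)) ≤ totalVar L u := by
  refine iSup₂_le fun φ hφ => ?_
  obtain ⟨h1, h2, h3, h4⟩ := hφ
  have hd : ∀ x, deriv (fun x => -φ (L - x)) x = deriv φ (L - x) := fun x => by
    rw [deriv.fun_neg, deriv_comp_const_sub, neg_neg]
  have hts : tsupport (fun x => -φ (L - x)) ⊆ (fun x => L - x) ⁻¹' tsupport φ := by
    refine closure_minimal (fun x hx => subset_tsupport _ fun h => hx (by simp [h]))
      ((isClosed_tsupport _).preimage (by fun_prop))
  refine le_trans (le_of_eq ?_) (totalVar_test_le (L := L) (u := u) (φ := fun x => -φ (L - x))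
    (by fun_prop) ?_ ?_ fun x => by rw [abs_neg]; exact h4 _)
  · simp only [hd]
    rw [← integral_Ioc_eq_integral_Ioo, ← integral_Ioc_eq_integral_Ioo]
    rcases le_total 0 L with hL | hL
    · rw [← intervalIntegral.integral_of_le hL, ← intervalIntegral.integral_of_le hL]
      have := intervalIntegral.integral_comp_sub_left (a := 0) (b := L)
        (fun x => u x * deriv φ (L - x)) L
      simp only [sub_sub_cancel, sub_self, sub_zero] at this
      rw [this]
    · simp [Ioc_eq_empty_of_le hL]
  · exact h2.comp_homeomorph (Homeomorph.subLeft L) |>.neg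
  · intro x hx
    have := h3 (hts hx)
    exact ⟨by linarith [this.2], by linarith [this.1]⟩

/-- The ramp `x ↦ min (x⁺ / r) 1`. -/
def ramp (r x : ℝ) : ℝ := max 0 (min (x / r) 1)

theorem lipschitzWith_ramp {r : ℝ} (hr : 0 < r) : LipschitzWith (Real.toNNReal r⁻¹) (ramp r) := by
  have h1 : LipschitzWith (Real.toNNReal r⁻¹) fun x : ℝ => x / r := by
    refine LipschitzWith.of_dist_le_mul fun x y => ?_
    rw [Real.dist_eq, Real.dist_eq, ← sub_div, abs_div, abs_of_pos hr,
      Real.coe_toNNReal _ (by positivity), div_eq_inv_mul]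
  exact (h1.min_const 1).const_max 0

theorem hasDerivAt_ramp {r x : ℝ} (hx0 : 0 < x) (hxr : x ≠ r) (hr : 0 < r) :
    HasDerivAt (ramp r) ((Ioo 0 r).indicator (fun _ => r⁻¹) x) x := by
  rcases lt_or_gt_of_ne hxr with h | h
  · rw [indicator_of_mem (show x ∈ Ioo 0 r from ⟨hx0, h⟩)]
    have : ramp r =ᶠ[𝓝 x] fun y => y / r := by
      filter_upwards [Ioo_mem_nhds hx0 h] with y hy
      rw [ramp, min_eq_left ((div_le_one hr).2 hy.2.le), max_eq_right (div_nonneg hy.1.le hr.le)]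
    rw [this.hasDerivAt_iff, ← one_div]
    exact (hasDerivAt_id x).div_const r
  · rw [indicator_of_notMem (fun h' : x ∈ Ioo 0 r => h'.2.not_gt h)]
    have : ramp r =ᶠ[𝓝 x] fun y => 1 := by
      filter_upwards [Ioi_mem_nhds h] with y hy
      rw [ramp, min_eq_right ((one_le_div hr).2 (le_of_lt hy)), max_eq_right zero_le_one]
    rw [this.hasDerivAt_iff]
    exact hasDerivAt_const x 1

theorem ramp_antitone (x : ℝ) {r s : ℝ} (hr : 0 < r) (hrs : r ≤ s) : ramp s x ≤ ramp r x := by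
  unfold ramp
  rcases le_total x 0 with hx | hx
  · have h1 : x / s ≤ 0 := div_nonpos_of_nonpos_of_nonneg hx (hr.le.trans hrs)
    rw [max_eq_left ((min_le_left _ _).trans h1)]
    exact le_max_left _ _
  · have : x / s ≤ x / r := by gcongr
    gcongr

theorem ramp_mem_Icc (r x : ℝ) : ramp r x ∈ Icc 0 1 :=
  ⟨le_max_left _ _, max_le zero_le_one (min_le_right _ _)⟩

theorem ramp_of_nonpos {r x : ℝ} (hr : 0 < r) (hx : x ≤ 0) : ramp r x = 0 :=
  max_eq_left ((min_le_left _ _).trans (div_nonpos_of_nonpos_of_nonneg hx hr.le))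

theorem ramp_of_ge {r x : ℝ} (hr : 0 < r) (hx : r ≤ x) : ramp r x = 1 := by
  rw [ramp, min_eq_right ((one_le_div hr).2 hx), max_eq_right zero_le_one]

/-- The mean of u over (0, r) is u integrated against the derivative of `ramp r`. A signed sum of
increments of the means is therefore u paired with ψ', where ψ is a signed sum of differences of
ramps. Since ramps decrease in r, these differences telescope to give |ψ| ≤ 1, so the variation of
the means is at most the total variation of u. -/
theorem boundedVariationOn_endMean_zero {L : ℝ} (hL : 0 < L) {u : ℝ → ℝ}
    (hu : IntegrableOn u (Ioo 0 L)) (hfin : totalVar L u < ∞) :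
    BoundedVariationOn (endMean L u 0) (Ioo 0 L) := by
  refine ne_top_of_le_ne_top hfin.ne (iSup_le fun ⟨n, p, hp, hpL⟩ => ?_)
  simp only
  set F := endMean L u 0
  -- The signs turn the paired increments into absolute values.
  set c : ℕ → ℝ := fun i => SignType.sign (F (p (i + 1)) - F (p i)) with hc
  set ψ : ℝ → ℝ := fun x => ∑ i ∈ Finset.range n, c i * (ramp (p (i + 1)) x - ramp (p i) x) with hψ
  have hc1 : ∀ i, |c i| ≤ 1 := fun i => by
    simp only [hc]
    rcases SignType.trichotomy (SignType.sign (F (p (i + 1)) - F (p i))) with h | h | h <;>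
      simp [h]
  have hp0 : ∀ i, 0 < p i := fun i => (hpL i).1
  have hlip : ∃ K, LipschitzWith K ψ := by
    have : ∀ m : ℕ, ∃ K, LipschitzWith K fun x => ∑ i ∈ Finset.range m,
        c i * (ramp (p (i + 1)) x - ramp (p i) x) := by
      intro m
      induction m with
      | zero => exact ⟨0, by simp⟩
      | succ m ih =>
        obtain ⟨K, hK⟩ := ih
        simp only [Finset.sum_range_succ]
        exact ⟨_, hK.add ((lipschitzWith_smul (c m)).comp
          ((lipschitzWith_ramp (hp0 (m + 1))).sub (lipschitzWith_ramp (hp0 m))))⟩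
    exact this n
  obtain ⟨K, hK⟩ := hlip
  have h0 : ∀ x, x ∉ Ioo 0 L → ψ x = 0 := by
    intro x hx
    refine Finset.sum_eq_zero fun i _ => ?_
    rcases le_or_gt x 0 with h | h
    · rw [ramp_of_nonpos (hp0 _) h, ramp_of_nonpos (hp0 _) h]; ring
    · have hxL : L ≤ x := not_lt.1 fun h' => hx ⟨h, h'⟩
      rw [ramp_of_ge (hp0 _) ((hpL _).2.le.trans hxL), ramp_of_ge (hp0 _) ((hpL _).2.le.trans hxL)]
      ring
  have h1 : ∀ x, |ψ x| ≤ 1 := by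
    intro x
    calc |ψ x| ≤ ∑ i ∈ Finset.range n, |c i * (ramp (p (i + 1)) x - ramp (p i) x)| :=
          Finset.abs_sum_le_sum_abs _ _
      _ ≤ ∑ i ∈ Finset.range n, (ramp (p i) x - ramp (p (i + 1)) x) := by
          refine Finset.sum_le_sum fun i _ => ?_
          have := ramp_antitone x (hp0 i) (hp (Nat.le_succ i))
          rw [abs_mul, abs_sub_comm, abs_of_nonneg (sub_nonneg.2 this)]
          exact mul_le_of_le_one_left (sub_nonneg.2 this) (hc1 i)
      _ = ramp (p 0) x - ramp (p n) x := Finset.sum_range_sub' (fun i => ramp (p i) x) n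
      _ ≤ 1 := by linarith [(ramp_mem_Icc (p 0) x).2, (ramp_mem_Icc (p n) x).1]
  have hmain := integral_mul_deriv_le_totalVar hL hu hK h0 h1 hfin
  have hi : ∀ i, Integrable (fun x => u x * (Ioo 0 (p i)).indicator (fun _ => (p i)⁻¹) x)
      (volume.restrict (Ioo 0 L)) := by
    intro i
    refine Integrable.mul_bdd (c := (p i)⁻¹) hu
      ((measurable_const.indicator measurableSet_Ioo).aestronglyMeasurable)
      (Eventually.of_forall fun x => ?_)
    have := inv_nonneg.2 (hp0 i).le
    refine (norm_indicator_le_norm_self _ _).trans ?_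
    rw [Real.norm_of_nonneg this]
  have hF : ∀ i, ∫ x in Ioo 0 L, u x * (Ioo 0 (p i)).indicator (fun _ => (p i)⁻¹) x = F (p i) := by
    intro i
    have : (fun x => u x * (Ioo 0 (p i)).indicator (fun _ => (p i)⁻¹) x)
        = (Ioo 0 (p i)).indicator fun x => (p i)⁻¹ * u x := by
      ext x
      by_cases hx : x ∈ Ioo 0 (p i) <;> simp [hx, mul_comm]
    rw [this, setIntegral_indicator measurableSet_Ioo, inter_eq_right.2
      (Ioo_subset_Ioo_right (hpL i).2.le), integral_const_mul]
    rfl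
  have hval : ∫ x in Ioo 0 L, u x * deriv ψ x
      = ∑ i ∈ Finset.range n, |F (p (i + 1)) - F (p i)| := by
    have hae : ∀ᵐ x ∂(volume.restrict (Ioo 0 L)), u x * deriv ψ x
        = ∑ i ∈ Finset.range n, c i *
          (u x * (Ioo 0 (p (i + 1))).indicator (fun _ => (p (i + 1))⁻¹) x
            - u x * (Ioo 0 (p i)).indicator (fun _ => (p i)⁻¹) x) := by
      have hne : ∀ᵐ x ∂(volume.restrict (Ioo 0 L)), ∀ i, x ≠ p i := by
        rw [ae_all_iff]
        intro i
        exact ae_restrict_of_ae (by simp [ae_iff, measure_singleton])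
      filter_upwards [hne, ae_restrict_mem measurableSet_Ioo] with x hx hxL
      have : HasDerivAt ψ (∑ i ∈ Finset.range n, c i *
          ((Ioo 0 (p (i + 1))).indicator (fun _ => (p (i + 1))⁻¹) x
            - (Ioo 0 (p i)).indicator (fun _ => (p i)⁻¹) x)) x :=
        HasDerivAt.fun_sum fun i _ => ((hasDerivAt_ramp hxL.1 (hx _) (hp0 _)).sub
          (hasDerivAt_ramp hxL.1 (hx _) (hp0 _))).const_mul _
      rw [this.deriv, Finset.mul_sum]
      refine Finset.sum_congr rfl fun i _ => by ring
    have hi' : ∀ i, Integrable (fun x => c i *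
        (u x * (Ioo 0 (p (i + 1))).indicator (fun _ => (p (i + 1))⁻¹) x
          - u x * (Ioo 0 (p i)).indicator (fun _ => (p i)⁻¹) x)) (volume.restrict (Ioo 0 L)) :=
      fun i => ((hi _).sub (hi _)).const_mul _
    rw [integral_congr_ae hae, integral_finsetSum _ fun i _ => hi' i]
    refine Finset.sum_congr rfl fun i _ => ?_
    rw [integral_const_mul, integral_sub (hi _) (hi _), hF, hF]
    exact sign_mul_self _
  rw [hval] at hmain
  have : ∑ i ∈ Finset.range n, edist (F (p (i + 1))) (F (p i))
      = ENNReal.ofReal (∑ i ∈ Finset.range n, |F (p (i + 1)) - F (p i)|) := by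
    rw [ENNReal.ofReal_sum_of_nonneg fun i _ => abs_nonneg _]
    refine Finset.sum_congr rfl fun i _ => ?_
    rw [edist_dist, Real.dist_eq]
  rw [this]
  exact (ENNReal.ofReal_le_iff_le_toReal hfin.ne).2 hmain

theorem exists_hasTrace_zero {L : ℝ} (hL : 0 < L) {u : ℝ → ℝ}
    (hu : IntegrableOn u (Ioo 0 L)) (hfin : totalVar L u < ∞) : ∃ c, HasTrace L u 0 c := by
  obtain ⟨c, hc⟩ := (boundedVariationOn_endMean_zero hL hu hfin).exists_tendsto_right 0
  refine ⟨c, hc.mono_left ?_⟩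
  refine nhdsWithin_le_iff.2 ?_
  filter_upwards [Ioo_mem_nhdsGT hL] with x hx
  exact ⟨hx, hx.1⟩

theorem endMean_one_eq (L : ℝ) (u : ℝ → ℝ) {r : ℝ} (hr : 0 < r) :
    endMean L u 1 r = endMean L (fun x => u (L - x)) 0 r := by
  simp only [endMean, one_ne_zero, if_false, if_true]
  rw [← integral_Ioc_eq_integral_Ioo, ← integral_Ioc_eq_integral_Ioo,
    ← intervalIntegral.integral_of_le (by linarith), ← intervalIntegral.integral_of_le hr.le,
    intervalIntegral.integral_comp_sub_left, sub_zero]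

/-- `trace` is a `limUnder`, hence meaningful only once the limit exists. At 0 it exists because the
means have bounded variation; at L by reflection. -/
theorem hasTrace_trace {L : ℝ} (hL : 0 < L) {u : ℝ → ℝ} (hu : IntegrableOn u (Ioo 0 L))
    (hfin : totalVar L u < ∞) (i : Fin 2) : HasTrace L u i (trace L u i) := by
  refine tendsto_nhds_limUnder ?_
  fin_cases i
  · exact exists_hasTrace_zero hL hu hfin
  · have hu' : IntegrableOn (fun x => u (L - x)) (Ioo 0 L) := by
      rw [← integrableOn_Ioc_iff_integrableOn_Ioo,
        ← intervalIntegrable_iff_integrableOn_Ioc_of_le hL.le] at hu ⊢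
      simpa using (hu.comp_sub_left L).symm
    obtain ⟨c, hc⟩ := exists_hasTrace_zero hL hu' ((totalVar_reflect_le L u).trans_lt hfin)
    refine ⟨c, hc.congr' ?_⟩
    filter_upwards [self_mem_nhdsWithin] with r hr
    exact (endMean_one_eq L u hr).symm

/-! ### The Green inequality -/

/-- The trapezoidal cutoff function vanishing off `(0, L)`, equal to `1` on `[r, L - r]`. -/
def cutoff (L r x : ℝ) : ℝ := ramp r x + ramp r (L - x) - 1

section Cutoff

variable {L r : ℝ}

theorem cutoff_mem_Icc (hr : 0 < r) (hrL : 2 * r < L) (x : ℝ) : cutoff L r x ∈ Icc 0 1 := by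
  unfold cutoff
  have h1 := ramp_mem_Icc r x
  have h2 := ramp_mem_Icc r (L - x)
  rcases le_or_gt r x with h | h
  · rw [ramp_of_ge hr h]
    exact ⟨by linarith [h2.1], by linarith [h2.2]⟩
  · rw [ramp_of_ge (x := L - x) hr (by linarith)]
    exact ⟨by linarith [h1.1], by linarith [h1.2]⟩

theorem cutoff_eq_zero (hr : 0 < r) (hrL : 2 * r < L) {x : ℝ} (hx : x ∉ Ioo 0 L) :
    cutoff L r x = 0 := by
  unfold cutoff
  rcases le_or_gt x 0 with h | h
  · rw [ramp_of_nonpos hr h, ramp_of_ge (x := L - x) hr (by linarith)]; ring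
  · have hxL : L ≤ x := not_lt.1 fun h' => hx ⟨h, h'⟩
    rw [ramp_of_ge hr (by linarith), ramp_of_nonpos (x := L - x) hr (by linarith)]; ring

theorem cutoff_eq_one (hr : 0 < r) {x : ℝ} (hx : r ≤ x) (hx' : x ≤ L - r) :
    cutoff L r x = 1 := by
  rw [cutoff, ramp_of_ge hr hx, ramp_of_ge (x := L - x) hr (by linarith)]; ring

theorem lipschitzWith_cutoff (hr : 0 < r) :
    LipschitzWith (Real.toNNReal r⁻¹ + Real.toNNReal r⁻¹) (cutoff L r) := by
  have h1 := lipschitzWith_ramp hr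
  have h2 : LipschitzWith (Real.toNNReal r⁻¹) fun x => ramp r (L - x) := by
    have := h1.comp (LipschitzWith.const (α := ℝ) L |>.sub LipschitzWith.id)
    rwa [zero_add, mul_one] at this
  have := (h1.add h2).sub (LipschitzWith.const (1 : ℝ))
  rwa [add_zero] at this

theorem hasDerivAt_cutoff {x : ℝ} (hr : 0 < r) (hx : x ∈ Ioo 0 L) (h1 : x ≠ r)
    (h2 : x ≠ L - r) : HasDerivAt (cutoff L r) ((endSet L 0 r).indicator (fun _ => r⁻¹) x
      - (endSet L 1 r).indicator (fun _ => r⁻¹) x) x := by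
  have d1 := hasDerivAt_ramp hx.1 h1 hr
  have d2 := HasDerivAt.comp_const_sub L x
    (hasDerivAt_ramp (x := L - x) (by linarith [hx.2]) (fun h => h2 (by linarith)) hr)
  have e : (endSet L 1 r).indicator (fun _ => r⁻¹) x
      = (Ioo 0 r).indicator (fun _ => r⁻¹) (L - x) := by
    have : x ∈ endSet L 1 r ↔ L - x ∈ Ioo 0 r := by
      simp only [endSet, one_ne_zero, if_false, mem_Ioo]
      constructor <;> intro h <;> constructor <;> linarith [h.1, h.2]
    by_cases h : L - x ∈ Ioo 0 r
    · rw [indicator_of_mem h, indicator_of_mem (this.2 h)]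
    · rw [indicator_of_notMem h, indicator_of_notMem (fun h' => h (this.1 h'))]
  rw [e, sub_eq_add_neg]
  exact (d1.add d2).sub_const 1

end Cutoff

theorem _root_.LipschitzWith.mul_of_abs_le_one {f g : ℝ → ℝ} {K K' : ℝ≥0} (hf : LipschitzWith K f)
    (hg : LipschitzWith K' g) (hf1 : ∀ x, |f x| ≤ 1) (hg1 : ∀ x, |g x| ≤ 1) :
    LipschitzWith (K + K') fun x => f x * g x := by
  refine LipschitzWith.of_dist_le_mul fun x y => ?_
  have h1 := hf.dist_le_mul x y
  have h2 := hg.dist_le_mul x y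
  rw [Real.dist_eq] at h1 h2 ⊢
  have : f x * g x - f y * g y = (f x - f y) * g x + f y * (g x - g y) := by ring
  rw [this, NNReal.coe_add, add_mul]
  refine (abs_add_le _ _).trans (add_le_add ?_ ?_)
  · rw [abs_mul]; exact (mul_le_of_le_one_right (abs_nonneg _) (hg1 x)).trans h1
  · rw [abs_mul]; exact (mul_le_of_le_one_left (abs_nonneg _) (hf1 y)).trans h2

theorem _root_.LipschitzWith.abs_deriv_le {f : ℝ → ℝ} {K : ℝ≥0} (hf : LipschitzWith K f) (x : ℝ) :
    |deriv f x| ≤ K := norm_deriv_le_of_lipschitz hf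

/-- One half of the Green formula: pairing with a vector field bounded by `1`. -/
theorem integral_mul_deriv_le_totalVar_add_trace {L : ℝ} (hL : 0 < L) {u z : ℝ → ℝ} {K : ℝ≥0}
    (hu : IntegrableOn u (Ioo 0 L)) (hfin : totalVar L u < ∞) (hz : LipschitzWith K z)
    (hz1 : ∀ x, |z x| ≤ 1) :
    ∫ x in Ioo 0 L, u x * deriv z x ≤
      (totalVar L u).toReal + trace L u 1 * z L - trace L u 0 * z 0 := by
  have hsmall : ∀ᶠ r in 𝓝[>] (0 : ℝ), 0 < r ∧ 2 * r < L := by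
    filter_upwards [Ioo_mem_nhdsGT (show (0 : ℝ) < L / 2 by linarith)] with r hr
    exact ⟨hr.1, by linarith [hr.2]⟩
  have hdz : ∀ μ : Measure ℝ, AEStronglyMeasurable (deriv z) μ := fun μ =>
    (measurable_deriv z).aestronglyMeasurable
  have huz : IntegrableOn (fun x => u x * z x) (Ioo 0 L) :=
    hu.mul_bdd (c := 1) hz.continuous.aestronglyMeasurable (Eventually.of_forall hz1)
  have hudz : IntegrableOn (fun x => u x * deriv z x) (Ioo 0 L) :=
    hu.mul_bdd (c := K) (hdz _) (Eventually.of_forall hz.abs_deriv_le)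
  have hmid : Tendsto (fun r => ∫ x in Ioo 0 L, u x * deriv z x * cutoff L r x) (𝓝[>] 0)
      (𝓝 (∫ x in Ioo 0 L, u x * deriv z x)) := by
    refine tendsto_integral_filter_of_dominated_convergence (fun x => ‖u x * deriv z x‖)
      ?_ ?_ hudz.norm ?_
    · filter_upwards [hsmall] with r hr
      exact hudz.aestronglyMeasurable.mul (lipschitzWith_cutoff hr.1).continuous.aestronglyMeasurable
    · filter_upwards [hsmall] with r hr
      refine Eventually.of_forall fun x => ?_
      have := cutoff_mem_Icc hr.1 hr.2 x
      rw [norm_mul, Real.norm_of_nonneg this.1]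
      exact mul_le_of_le_one_right (norm_nonneg _) this.2
    · filter_upwards [ae_restrict_mem measurableSet_Ioo] with x hx
      refine Tendsto.congr' ?_ tendsto_const_nhds
      filter_upwards [Ioo_mem_nhdsGT hx.1, Ioo_mem_nhdsGT (show 0 < L - x by linarith [hx.2])]
        with r h1 h2
      rw [cutoff_eq_one h1.1 h1.2.le (by linarith [h2.2]), mul_one]
  have h0 := (hasTrace_trace hL hu hfin 0).mul_lipschitz hL hu hz
  have h1 := (hasTrace_trace hL hu hfin 1).mul_lipschitz hL hu hz
  have hlim := (hmid.add h0).sub h1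
  have hle := le_of_tendsto hlim (hsmall.mono fun r hr => ?_) (b := (totalVar L u).toReal)
  · simp only [endpt, Matrix.cons_val_zero, Matrix.cons_val_one] at hle
    linarith
  have hrL : r ≤ L := by linarith
  have hψ1 : ∀ x, |cutoff L r x| ≤ 1 := fun x => by
    have := cutoff_mem_Icc hr.1 hr.2 x
    rw [abs_of_nonneg this.1]; exact this.2
  -- z times the cutoff vanishes off (0, L). The cutoff has slope 1/r on the left end set and -1/r
  -- on the right one, so its derivative produces exactly the boundary means of u z, whose limits
  -- are the trace terms.
  have hmain := integral_mul_deriv_le_totalVar hL hu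
    (hz.mul_of_abs_le_one (lipschitzWith_cutoff hr.1) hz1 hψ1)
    (fun x hx => by rw [cutoff_eq_zero hr.1 hr.2 hx, mul_zero])
    (fun x => by rw [abs_mul]; exact mul_le_one₀ (hz1 x) (abs_nonneg _) (hψ1 x)) hfin
  refine le_of_eq_of_le ?_ hmain
  have hiE : ∀ i, Integrable (fun x => (endSet L i r).indicator (fun x => r⁻¹ * (u x * z x)) x)
      (volume.restrict (Ioo 0 L)) := fun i =>
    (huz.const_mul _).indicator (measurableSet_endSet L i r)
  have hE : ∀ i, ∫ x in Ioo 0 L, (endSet L i r).indicator (fun x => r⁻¹ * (u x * z x)) x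
      = endMean L (fun x => u x * z x) i r := fun i => by
    rw [setIntegral_indicator (measurableSet_endSet L i r), inter_eq_right.2 (endSet_subset i hrL),
      integral_const_mul]
    rfl
  have hiM : Integrable (fun x => u x * deriv z x * cutoff L r x) (volume.restrict (Ioo 0 L)) :=
    hudz.mul_bdd (c := 1) (lipschitzWith_cutoff hr.1).continuous.aestronglyMeasurable
      (Eventually.of_forall hψ1)
  have hiM0 : Integrable (fun x => u x * deriv z x * cutoff L r x
      + (endSet L 0 r).indicator (fun x => r⁻¹ * (u x * z x)) x)
      (volume.restrict (Ioo 0 L)) := hiM.add (hiE 0)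
  rw [← hE 0, ← hE 1, ← integral_add hiM (hiE 0), ← integral_sub hiM0 (hiE 1)]
  refine integral_congr_ae ?_
  have hne : ∀ c : ℝ, ∀ᵐ x ∂(volume.restrict (Ioo 0 L)), x ≠ c := fun c =>
    ae_restrict_of_ae (by simp [ae_iff, measure_singleton])
  filter_upwards [hne r, hne (L - r), ae_restrict_mem measurableSet_Ioo,
    ae_restrict_of_ae hz.ae_differentiableAt] with x h1 h2 hx hd
  have := hd.hasDerivAt.mul (hasDerivAt_cutoff hr.1 hx h1 h2)
  rw [show (fun x => z x * cutoff L r x) = z * cutoff L r from rfl, this.deriv]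
  by_cases m0 : x ∈ endSet L 0 r <;> by_cases m1 : x ∈ endSet L 1 r <;> simp [m0, m1] <;> ring

/-- Integration by parts moves the derivative to f. As f' ≥ 0 and |φ| ≤ 1, the pairing is at most ∫
f', which is the total rise. -/
theorem totalVar_le_of_monotoneOn {L χ : ℝ} (hL : 0 < L) (hχ : |χ| = 1) {f : ℝ → ℝ} {K : ℝ≥0}
    (hf : LipschitzOnWith K f (Icc 0 L)) (hm : MonotoneOn f (Icc 0 L)) :
    totalVar L (fun x => χ * f x) ≤ ENNReal.ofReal (f L - f 0) := by
  refine iSup₂_le fun φ hφ => ENNReal.ofReal_le_ofReal ?_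
  obtain ⟨h1, h2, h3, h4⟩ := hφ
  have hφ0 : ∀ x, x ∉ Ioo 0 L → φ x = 0 := fun x hx =>
    image_eq_zero_of_notMem_tsupport fun h => hx (h3 h)
  have hfa : AbsolutelyContinuousOnInterval f 0 L :=
    LipschitzOnWith.absolutelyContinuousOnInterval (by rwa [uIcc_of_le hL.le])
  have hφa : AbsolutelyContinuousOnInterval φ 0 L :=
    h1.contDiffOn.absolutelyContinuousOnInterval
  have hparts := hfa.integral_mul_deriv_eq_deriv_mul hφa
  rw [hφ0 0 (by simp), hφ0 L (by simp)] at hparts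
  have hf' := hfa.integral_deriv_eq_sub
  rw [intervalIntegral.integral_of_le hL.le, integral_Ioc_eq_integral_Ioo] at hf'
  rw [intervalIntegral.integral_of_le hL.le, intervalIntegral.integral_of_le hL.le,
    integral_Ioc_eq_integral_Ioo, integral_Ioc_eq_integral_Ioo] at hparts
  have hint : IntegrableOn (deriv f) (Ioo 0 L) :=
    ((intervalIntegrable_iff_integrableOn_Ioc_of_le hL.le).1
      hfa.intervalIntegrable_deriv).mono_set Ioo_subset_Ioc_self
  simp only [mul_assoc]
  rw [integral_const_mul, hparts, ← hf']
  simp only [mul_zero, sub_zero, zero_sub]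
  have habs : |∫ x in Ioo 0 L, deriv f x * φ x| ≤ ∫ x in Ioo 0 L, deriv f x := by
    refine norm_integral_le_of_norm_le (f := fun x => deriv f x * φ x) hint ?_
    filter_upwards [ae_restrict_mem measurableSet_Ioo] with x hx
    have hd : 0 ≤ deriv f x := by
      rw [← derivWithin_of_mem_nhds (Icc_mem_nhds hx.1 hx.2)]
      exact hm.derivWithin_nonneg
    rw [norm_mul, Real.norm_of_nonneg hd]
    exact mul_le_of_le_one_right hd (h4 x)
  calc χ * -∫ x in Ioo 0 L, deriv f x * φ x ≤ |χ * -∫ x in Ioo 0 L, deriv f x * φ x| :=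
        le_abs_self _
    _ ≤ _ := by rw [abs_mul, hχ, abs_neg, one_mul]; exact habs

/-! ### Calibrable and coherent facets -/

/-- Expand ∫ (w - l)² + (m + l)² ≥ 0. The free trace m on Γ cancels by the divergence constraint,
leaving 2le - l²(1 + q - p), and the choice of l makes this the left-hand side. Equality forces w =
l and m = -l, which is calibrability together with coherence for τ = 1. -/
theorem facet_energy_lower_bound {p q l e m : ℝ} {w : ℝ → ℝ} (hpq : p ≤ q)
    (hw : MemLp w 2 (volume.restrict (Icc p q))) (hl : l * (1 + (q - p)) = e)
    (hint : ∫ x in Icc p q, w x = e + m) :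
    l ^ 2 * (q - p) + l ^ 2 ≤ (∫ x in Icc p q, w x ^ 2) + m ^ 2 := by
  have hw1 : Integrable w (volume.restrict (Icc p q)) := hw.integrable (by norm_num)
  have hw2 : Integrable (fun x => w x ^ 2) (volume.restrict (Icc p q)) := hw.integrable_sq
  have hc : ∫ _ in Icc p q, l ^ 2 = (q - p) * l ^ 2 := by
    rw [setIntegral_const, measureReal_def, Real.volume_Icc,
      ENNReal.toReal_ofReal (by linarith), smul_eq_mul]
  have h0 : 0 ≤ ∫ x in Icc p q, (w x ^ 2 - 2 * l * w x + l ^ 2) :=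
    integral_nonneg fun x => by
      show 0 ≤ w x ^ 2 - 2 * l * w x + l ^ 2
      nlinarith [sq_nonneg (w x - l)]
  have hsub : Integrable (fun x => w x ^ 2 - 2 * l * w x) (volume.restrict (Icc p q)) :=
    hw2.sub (hw1.const_mul _)
  rw [integral_add hsub (integrable_const _),
    integral_sub hw2 (hw1.const_mul _), integral_const_mul, hint, hc] at h0
  subst hl
  nlinarith [sq_nonneg (m + l)]

theorem affine_green {p q : ℝ} (hpq : p ≤ q) (c l : ℝ) {φ : ℝ → ℝ} (hφ : ContDiff ℝ 1 φ) :
    (∫ x in Icc p q, l * φ x) + (∫ x in Icc p q, (c + l * x) * deriv φ x)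
      = -(c + l * p) * φ p + (c + l * q) * φ q := by
  have hφ' : Continuous (deriv φ) := hφ.continuous_deriv le_rfl
  rw [integral_Icc_eq_integral_Ioc, integral_Icc_eq_integral_Ioc,
    ← intervalIntegral.integral_of_le hpq, ← intervalIntegral.integral_of_le hpq,
    ← intervalIntegral.integral_add (by
      have := hφ.continuous
      exact Continuous.intervalIntegrable (by fun_prop) _ _)
      (Continuous.intervalIntegrable (by fun_prop) _ _)]
  have hd : ∀ x ∈ uIcc p q, HasDerivAt (fun x => (c + l * x) * φ x)
      (l * φ x + (c + l * x) * deriv φ x) x := fun x _ => by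
    have h1 : HasDerivAt (fun x : ℝ => c + l * x) l x := by
      simpa using ((hasDerivAt_id x).const_mul l).const_add c
    exact h1.mul ((hφ.differentiable one_ne_zero) x).hasDerivAt
  rw [intervalIntegral.integral_eq_sub_of_hasDerivAt hd (by
    have := hφ.continuous
    exact Continuous.intervalIntegrable (by fun_prop) _ _)]
  ring

theorem isFacet_const {L p q σ : ℝ} (h0 : 0 ≤ p) (hpq : p < q) (hq : q ≤ L)
    (hσ : σ = 1 ∨ σ = -1) : IsFacet L p q fun _ => σ :=
  ⟨h0, hpq, hq, continuousOn_const, fun _ _ => hσ⟩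

theorem IsCahnHoffman.integral_div {L : ℝ} {Γ : Set ℝ} {p q : ℝ} {d z w : ℝ → ℝ} {n : Fin 2 → ℝ}
    (h : IsCahnHoffman L Γ p q d z w n) : ∫ x in Icc p q, w x = n 0 + n 1 := by
  simpa using h.green (fun _ => 1) contDiff_const

theorem isCahnHoffman_affine {L p q c l : ℝ} {d : ℝ → ℝ} (hpq : p ≤ q)
    (hb : ∀ x ∈ Icc p q, |c + l * x| ≤ 1)
    (hl : p ∈ Ioo 0 L → Tendsto d (𝓝[<] p) (𝓝 (-(c + l * p))))
    (hr : q ∈ Ioo 0 L → Tendsto d (𝓝[>] q) (𝓝 (c + l * q))) :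
    IsCahnHoffman L {0, L} p q d (fun x => c + l * x) (fun _ => l) ![-(c + l * p), c + l * q] where
  meas := Continuous.aestronglyMeasurable (by fun_prop)
  bound := (ae_restrict_mem measurableSet_Icc).mono hb
  div_memLp := memLp_const l
  green φ hφ := affine_green hpq c l hφ
  inner_left := hl
  inner_right := hr
  neumann_left h := absurd h.1 h.2
  neumann_right h := absurd h.1 h.2

/-- The end point with index j lies on Γ and its trace is free; at index k all Cahn–Hoffman fields
have the same trace, prescribed by d. Since ∫ div z is the sum of the two traces, the affine field
has trace -l at j and attains the bound of `facet_energy_lower_bound`. -/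
theorem isCalibrable_and_isCoherent_of_affine {L p q c l : ℝ} {d : ℝ → ℝ} (hpq : p < q)
    (hfacet : IsFacet L p q d) {j k : Fin 2} (hjk : j ≠ k)
    (hΓ : gammaF {0, L} p q = {j})
    (hz : IsCahnHoffman L {0, L} p q d (fun x => c + l * x) (fun _ => l)
      ![-(c + l * p), c + l * q])
    (hin : ∀ z w n, IsCahnHoffman L {0, L} p q d z w n → n k = l * (1 + (q - p))) :
    IsCalibrable 1 L {0, L} p q d ∧ IsCoherent 1 L {0, L} p q d := by
  set n : Fin 2 → ℝ := ![-(c + l * p), c + l * q]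
  have hsum : ∀ m : Fin 2 → ℝ, m 0 + m 1 = m k + m j := fun m => by
    fin_cases j <;> fin_cases k <;> simp [add_comm] at hjk ⊢
  have hconst : ∀ c' : ℝ, ∫ _ in Icc p q, c' = (q - p) * c' := fun c' => by
    rw [setIntegral_const, measureReal_def, Real.volume_Icc,
      ENNReal.toReal_ofReal (by linarith), smul_eq_mul]
  have hnj : n j = -l := by
    have h1 := hz.integral_div
    rw [hsum n, hin _ _ _ hz, hconst] at h1
    linarith
  have hmin : IsMinimalCahnHoffman 1 L {0, L} p q d (fun x => c + l * x) (fun _ => l) n := by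
    refine ⟨hz, fun z' w' n' h' => ?_⟩
    have := facet_energy_lower_bound (m := n' j) hpq.le h'.div_memLp rfl (by
      rw [h'.integral_div, hsum n', hin _ _ _ h'])
    simp only [facetEnergy, hΓ, Finset.sum_singleton, inv_one, one_mul, hnj, hconst]
    linarith
  refine ⟨⟨hfacet, _, _, _, hmin, ⟨l, Eventually.of_forall fun _ => rfl⟩, ⟨-l, fun i hi => ?_⟩⟩,
    ⟨hfacet, _, _, _, hmin, ?_⟩⟩
  · rw [hΓ, Finset.mem_singleton] at hi
    rw [hi, hnj]
  · rw [hΓ, Finset.sum_singleton, hnj, hconst, Finset.card_singleton,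
      inv_mul_cancel_left₀ (sub_ne_zero.2 hpq.ne')]
    simp

/-- The value equals χ(1 - s/(1 + ℓ)): the field runs from χ at the inner end to χ/(1 + ℓ) at the
boundary without changing sign. -/
theorem abs_le_one_of_convex {χ l s : ℝ} (hχ : χ = 1 ∨ χ = -1) {ℓ : ℝ}
    (hl : l * (1 + ℓ) = -χ) (hs : 0 ≤ s) (hsℓ : s ≤ ℓ) : |χ + l * s| ≤ 1 := by
  have hpos : 0 < 1 + ℓ := by linarith
  have hl' : l = -χ / (1 + ℓ) := by rw [eq_div_iff hpos.ne', hl]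
  have h1 : s / (1 + ℓ) ≤ 1 := by rw [div_le_one hpos]; linarith
  have h2 : 0 ≤ s / (1 + ℓ) := by positivity
  have : χ + l * s = χ * (1 - s / (1 + ℓ)) := by rw [hl']; field_simp; ring
  rw [this, abs_mul]
  have hc : |χ| = 1 := by rcases hχ with h | h <;> simp [h]
  rw [hc, one_mul, abs_le]
  constructor <;> linarith

theorem right_facet_calibrable_coherent {L b χ : ℝ} (hb : 0 < b) (hbL : b < L)
    (hχ : χ = 1 ∨ χ = -1) :
    IsCalibrable 1 L {0, L} b L (fun _ => -χ) ∧ IsCoherent 1 L {0, L} b L (fun _ => -χ) := by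
  have hpos : 0 < 1 + (L - b) := by linarith
  set l := -χ / (1 + (L - b)) with hl
  have hl' : l * (1 + (L - b)) = -χ := div_mul_cancel₀ _ hpos.ne'
  -- The constant term makes the field equal to χ at b; there the outer normal is -1, so the normal
  -- trace is -χ.
  refine isCalibrable_and_isCoherent_of_affine (c := χ - l * b) (l := l) (j := 1) (k := 0) hbL
    (isFacet_const hb.le hbL le_rfl (by rcases hχ with h | h <;> simp [h])) (by decide) ?_ ?_ ?_
  · ext i
    fin_cases i
    · simp [gammaF, hb.ne', hbL.ne]
    · simp [gammaF]
  · refine isCahnHoffman_affine hbL.le (fun x hx => ?_) (fun _ => ?_) fun h => absurd h.2 (lt_irrefl _)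
    · rw [show χ - l * b + l * x = χ + l * (x - b) by ring]
      exact abs_le_one_of_convex hχ hl' (by linarith [hx.1]) (by linarith [hx.2])
    · rw [show χ - l * b + l * b = χ by ring]
      exact tendsto_const_nhds
  · intro z w n h
    rw [hl']
    exact tendsto_nhds_unique (h.inner_left ⟨hb, hbL⟩) tendsto_const_nhds

theorem left_facet_calibrable_coherent {L a χ : ℝ} (ha : 0 < a) (haL : a < L)
    (hχ : χ = 1 ∨ χ = -1) :
    IsCalibrable 1 L {0, L} 0 a (fun _ => χ) ∧ IsCoherent 1 L {0, L} 0 a (fun _ => χ) := by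
  have hpos : 0 < 1 + (a - 0) := by linarith
  set l := χ / (1 + (a - 0)) with hl
  have hl' : l * (1 + (a - 0)) = χ := div_mul_cancel₀ _ hpos.ne'
  refine isCalibrable_and_isCoherent_of_affine (c := χ - l * a) (l := l) (j := 0) (k := 1) ha
    (isFacet_const le_rfl ha haL.le hχ) (by decide) ?_ ?_ ?_
  · ext i
    fin_cases i
    · simp [gammaF]
    · simp [gammaF, ha.ne', haL.ne]
  · refine isCahnHoffman_affine ha.le (fun x hx => ?_) (fun h => absurd h.1 (lt_irrefl _)) fun _ => ?_
    · rw [show χ - l * a + l * x = χ + -l * (a - x) by ring]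
      exact abs_le_one_of_convex (ℓ := a) hχ (by rw [← hl']; ring) (by linarith [hx.2])
        (by linarith [hx.1])
    · rw [show χ - l * a + l * a = χ by ring]
      exact tendsto_const_nhds
  · intro z w n h
    rw [hl']
    exact tendsto_nhds_unique (h.inner_right ⟨ha, haL⟩) tendsto_const_nhds

/-! ### Motion of the two facets -/

/-- Extending f by slope 1 beyond [0, β] gives an increasing homeomorphism of the line. Its inverse,
clamped to [0, β], is defined everywhere, so the height equations have global right-hand sides. -/
theorem exists_continuous_inverse {β : ℝ} (hβ : 0 < β) {f : ℝ → ℝ}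
    (hc : ContinuousOn f (Icc 0 β)) (hm : StrictMonoOn f (Icc 0 β)) :
    ∃ A : ℝ → ℝ, Continuous A ∧ (∀ s, A s ∈ Icc 0 β) ∧ ∀ s ∈ Icc (f 0) (f β), f (A s) = s := by
  set π : ℝ → ℝ := fun x => max 0 (min β x) with hπ
  have hπc : Continuous π := by fun_prop
  have hπm : ∀ x, π x ∈ Icc 0 β := fun x => ⟨le_max_left _ _, max_le hβ.le (min_le_left _ _)⟩
  have hπid : ∀ x ∈ Icc 0 β, π x = x := fun x hx => by
    simp only [hπ, min_eq_right hx.2, max_eq_right hx.1]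
  set F : ℝ → ℝ := fun x => f (π x) + (x - π x) with hF
  have hFc : Continuous F := (hc.comp_continuous hπc hπm).add (continuous_id.sub hπc)
  have hFid : ∀ x ∈ Icc 0 β, F x = f x := fun x hx => by simp [hF, hπid x hx]
  have hFm : StrictMono F := fun x y hxy => by
    have h1 : π x ≤ π y := max_le_max le_rfl (min_le_min le_rfl hxy.le)
    have h2 : x - π x ≤ y - π y := by
      simp only [hπ]; grind
    rcases h1.lt_or_eq with h | h
    · have := hm (hπm x) (hπm y) h
      simp only [hF]; linarith
    · simp only [hF, h]; linarith
  have hmono := hm.monotoneOn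
  have h0 : (0 : ℝ) ∈ Icc 0 β := ⟨le_rfl, hβ.le⟩
  have h1 : β ∈ Icc 0 β := ⟨hβ.le, le_rfl⟩
  have hFs : Function.Surjective F := by
    refine hFc.surjective ?_ ?_
    · refine tendsto_atTop_mono (fun x => ?_)
        (tendsto_atTop_add_const_right atTop (f 0 - β) tendsto_id)
      have := hmono h0 (hπm x) (hπm x).1
      simp only [hF, id]; linarith [(hπm x).2]
    · refine tendsto_atBot_mono (fun x => ?_)
        (tendsto_atBot_add_const_right atBot (f β) tendsto_id)
      have := hmono (hπm x) h1 (hπm x).2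
      simp only [hF, id]; linarith [(hπm x).1]
  set e := hFm.orderIsoOfSurjective F hFs
  have hFe : ∀ s, F (e.symm s) = s := fun s => e.apply_symm_apply s
  refine ⟨fun s => π (e.symm s), hπc.comp e.symm.continuous, fun s => hπm _, fun s hs => ?_⟩
  have hmem : e.symm s ∈ Icc 0 β := by
    constructor
    · refine hFm.le_iff_le.1 ?_
      rw [hFe, hFid 0 h0]; exact hs.1
    · refine hFm.le_iff_le.1 ?_
      rw [hFe, hFid β h1]; exact hs.2
  show f (π (e.symm s)) = s
  rw [hπid _ hmem, ← hFid _ hmem, hFe]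

/-- The motion of the two boundary facets `[0, a(t)]` and `[b(t), L]`, of heights `hl`, `hr`, for
the increasing profile `f`, up to the time `T` when they meet. -/
structure FacetMotion (L β : ℝ) (f : ℝ → ℝ) (T : ℝ) (a b hl hr : ℝ → ℝ) : Prop where
  time_pos : 0 < T
  meet : a T = b T
  meet_height : hl T = hr T
  a_zero : a 0 = 0
  b_zero : b 0 = β
  hl_zero : hl 0 = f 0
  hr_zero : hr 0 = f β
  a_mem : ∀ t, a t ∈ Icc 0 β
  b_mem : ∀ t, b t ∈ Icc 0 β
  a_cont : Continuous a
  f_a : ∀ t ∈ Icc 0 T, f (a t) = hl t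
  f_b : ∀ t ∈ Icc 0 T, f (b t) = hr t
  hl_mono : StrictMono hl
  hr_anti : StrictAnti hr
  hl_deriv : ∀ t, HasDerivAt hl (1 / (1 + a t)) t
  hr_deriv : ∀ t, HasDerivAt hr (-(1 / (1 + L - b t))) t

theorem exists_facetMotion {L β : ℝ} (hβ : 0 < β) (hβL : β < L) {f : ℝ → ℝ}
    (hc : ContinuousOn f (Icc 0 β)) (hm : StrictMonoOn f (Icc 0 β)) :
    ∃ T a b hl hr, FacetMotion L β f T a b hl hr := by
  obtain ⟨A, hA, hAm, hfA⟩ := exists_continuous_inverse hβ hc hm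
  obtain ⟨hl, hl0, hlm, hls, hld⟩ := exists_autonomous_ode_solution (k := fun s => 1 + A s)
    (by fun_prop) (fun s => by linarith [(hAm s).1]) (f 0)
  -- The descending right height is t ↦ g(-t), so the same existence result serves both facets.
  obtain ⟨g, g0, gm, -, gd⟩ := exists_autonomous_ode_solution (k := fun s => 1 + L - A s)
    (by fun_prop) (fun s => by linarith [(hAm s).2]) (f β)
  have hlc : Continuous hl := continuous_iff_continuousAt.2 fun t => (hld t).continuousAt
  have gc : Continuous g := continuous_iff_continuousAt.2 fun t => (gd t).continuousAt
  have m0 : (0 : ℝ) ∈ Icc 0 β := ⟨le_rfl, hβ.le⟩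
  have m1 : β ∈ Icc 0 β := ⟨hβ.le, le_rfl⟩
  have hf01 : f 0 < f β := hm m0 m1 hβ
  -- At time S the left height has reached f β while the right one has already dropped below it, so
  -- they meet at some T < S. Up to T both heights remain in the range where A inverts f.
  obtain ⟨S, hS⟩ := hls (f β)
  have hS0 : 0 < S := hlm.lt_iff_lt.1 (by rw [hl0, hS]; exact hf01)
  obtain ⟨T, hT, hTeq⟩ : ∃ T ∈ Ioo 0 S, hl T - g (-T) = 0 := by
    have := intermediate_value_Ioo hS0.le (f := fun t => hl t - g (-t))
      (by fun_prop : Continuous fun t => hl t - g (-t)).continuousOn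
    refine this ⟨?_, ?_⟩
    · simp only [neg_zero, hl0, g0]; linarith
    · have := gm (neg_lt_zero.2 hS0)
      simp only [hS]; linarith
  have hTeq' : hl T = g (-T) := sub_eq_zero.1 hTeq
  have hlmem : ∀ t ∈ Icc 0 T, hl t ∈ Icc (f 0) (f β) := fun t ht => by
    rw [← hl0, ← hS]
    exact ⟨hlm.monotone ht.1, hlm.monotone (ht.2.trans hT.2.le)⟩
  have hrmem : ∀ t ∈ Icc 0 T, g (-t) ∈ Icc (f 0) (f β) := fun t ht => by
    constructor
    · have h1 : g (-T) ≤ g (-t) := gm.monotone (by linarith [ht.2])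
      have h2 := (hlmem T ⟨hT.1.le, le_rfl⟩).1
      linarith
    · rw [← g0]; exact gm.monotone (by linarith [ht.1])
  exact ⟨T, fun t => A (hl t), fun t => A (g (-t)), hl, fun t => g (-t),
    { time_pos := hT.1
      meet := by simp only [hTeq']
      meet_height := hTeq'
      a_zero := by
        refine hm.injOn (hAm _) m0 ?_
        rw [hl0, hfA _ ⟨le_rfl, hf01.le⟩]
      b_zero := by
        refine hm.injOn (hAm _) m1 ?_
        rw [neg_zero, g0, hfA _ ⟨hf01.le, le_rfl⟩]
      hl_zero := hl0
      hr_zero := by rw [neg_zero, g0]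
      a_mem := fun t => hAm _
      b_mem := fun t => hAm _
      a_cont := hA.comp hlc
      f_a := fun t ht => hfA _ (hlmem t ht)
      f_b := fun t ht => hfA _ (hrmem t ht)
      hl_mono := hlm
      hr_anti := fun s t hst => gm (neg_lt_neg hst)
      hl_deriv := hld
      hr_deriv := fun t => by
        have := (gd (-t)).scomp t (hasDerivAt_neg t)
        simpa [Function.comp_def] using this }⟩

/-! ### Differentiation in L² and the energy on H -/

/-- Pointwise difference quotients are uniformly bounded by C, so on a finite measure space their
almost everywhere convergence becomes L² convergence by domination. -/
theorem hasDerivWithinAt_memLp_toLp {α : Type*} [MeasurableSpace α] {μ : Measure α}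
    [IsFiniteMeasure μ] {f : ℝ → α → ℝ} (hf : ∀ t, MemLp (f t) 2 μ) {C : ℝ} {t : ℝ}
    (hC : ∀ s x, |f s x - f t x| ≤ C * |s - t|) {w : α → ℝ} (hw : MemLp w 2 μ)
    (hwC : ∀ x, |w x| ≤ C) {S : Set ℝ}
    (h : ∀ᵐ x ∂μ, HasDerivWithinAt (fun s => f s x) (w x) S t) :
    HasDerivWithinAt (fun s => (hf s).toLp (f s)) (hw.toLp w) S t := by
  rw [hasDerivWithinAt_iff_tendsto_slope]
  have hq : ∀ s, MemLp ((s - t)⁻¹ • (f s - f t)) 2 μ := fun s => ((hf s).sub (hf t)).const_smul _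
  have hslope : slope (fun s => (hf s).toLp (f s)) t
      = fun s => (hq s).toLp ((s - t)⁻¹ • (f s - f t)) := by
    ext1 s
    rw [slope_def_module, ← MemLp.toLp_sub, ← MemLp.toLp_const_smul]
  rw [hslope, Lp.tendsto_Lp_iff_tendsto_eLpNorm'']
  have hlim : Tendsto (fun s => ∫⁻ x, ‖((s - t)⁻¹ • (f s - f t) - w) x‖ₑ ^ (2 : ℝ) ∂μ)
      (𝓝[S \ {t}] t) (𝓝 (∫⁻ _, 0 ∂μ)) := by
    refine tendsto_lintegral_filter_of_dominated_convergence'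
      (fun _ => ENNReal.ofReal (C + C) ^ (2 : ℝ)) ?_ ?_ ?_ ?_
    · exact Eventually.of_forall fun s => ((hq s).sub hw).aestronglyMeasurable.enorm.pow_const _
    · filter_upwards [self_mem_nhdsWithin] with s hs
      refine Eventually.of_forall fun x => ?_
      gcongr
      rw [Real.enorm_eq_ofReal_abs]
      refine ENNReal.ofReal_le_ofReal ?_
      have hst : 0 < |s - t| := abs_pos.2 (sub_ne_zero.2 hs.2)
      simp only [Pi.sub_apply, Pi.smul_apply, smul_eq_mul]
      refine (abs_sub _ _).trans (add_le_add ?_ (hwC x))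
      rw [abs_mul, abs_inv, inv_mul_le_iff₀ hst, mul_comm]
      exact hC s x
    · rw [lintegral_const]
      exact ENNReal.mul_ne_top (by simp) (measure_ne_top μ _)
    · filter_upwards [h] with x hx
      have h1 := (hasDerivWithinAt_iff_tendsto_slope.1 hx).sub_const (w x)
      rw [sub_self] at h1
      have h2 := (h1.enorm).ennrpow_const 2
      simp only [enorm_zero] at h2
      rw [ENNReal.zero_rpow_of_pos two_pos] at h2
      refine h2.congr fun s => ?_
      simp [slope_def_field, div_eq_inv_mul]
  rw [lintegral_zero] at hlim
  have := hlim.ennrpow_const (1 / (2 : ℝ))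
  rw [ENNReal.zero_rpow_of_pos (by norm_num)] at this
  refine this.congr fun s => ?_
  rw [eLpNorm_eq_lintegral_rpow_enorm_toReal two_ne_zero ENNReal.ofNat_ne_top,
    ENNReal.toReal_ofNat]

section EnergySpace

variable {L : ℝ}

theorem integrableOn_fst (U : H L) : IntegrableOn (U.fst : ℝ → ℝ) (Ioo 0 L) :=
  (Lp.memLp U.fst).integrable (by norm_num)

theorem totalVar_lt_top_of_energy_ne_top {U : H L} (h : energy L U ≠ ∞) :
    totalVar L U.fst < ∞ := by
  by_contra h'
  exact h (by rw [energy, if_neg h'])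

theorem energy_ne_top {U : H L} (h : totalVar L U.fst < ∞) : energy L U ≠ ∞ := by
  rw [energy, if_pos h]
  exact ENNReal.add_ne_top.2 ⟨h.ne, ENNReal.sum_ne_top.2 fun _ _ => ENNReal.ofReal_ne_top⟩

theorem toReal_energy {U : H L} (h : totalVar L U.fst < ∞) :
    (energy L U).toReal = (totalVar L U.fst).toReal
      + (|trace L U.fst 0 - U.snd 0| + |trace L U.fst 1 - U.snd 1|) := by
  rw [energy, if_pos h, ENNReal.toReal_add h.ne
    (ENNReal.sum_ne_top.2 fun _ _ => ENNReal.ofReal_ne_top),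
    ENNReal.toReal_sum fun _ _ => ENNReal.ofReal_ne_top, Fin.sum_univ_two,
    ENNReal.toReal_ofReal (abs_nonneg _), ENNReal.toReal_ofReal (abs_nonneg _)]

theorem inner_H (U V : H L) : ⟪U, V⟫_ℝ
    = (∫ x in Ioo 0 L, U.fst x * V.fst x) + (U.snd 0 * V.snd 0 + U.snd 1 * V.snd 1) := by
  rw [WithLp.prod_inner_apply, L2.inner_def, PiLp.inner_apply, Fin.sum_univ_two]
  simp only [RCLike.inner_apply, conj_trivial]
  simp only [mul_comm]
  rfl

/-- A Lipschitz field `z`, `|z| ≤ 1`, with `W = (div z, -[z·ν])` and `-⟪W, U⟫ = E(U)` certifies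
`-W ∈ ∂E(U)`. -/
theorem neg_mem_subdifferential_energy (hL : 0 < L) {U W : H L} {z : ℝ → ℝ} {K : ℝ≥0}
    (hz : LipschitzWith K z) (hz1 : ∀ x, |z x| ≤ 1)
    (hW : W.fst =ᵐ[volume.restrict (Ioo 0 L)] deriv z) (hW0 : W.snd 0 = z 0)
    (hW1 : W.snd 1 = -z L) (hU : totalVar L U.fst < ∞)
    (hE : (energy L U).toReal ≤ -⟪W, U⟫_ℝ) : -W ∈ subdifferential (energy L) U := by
  refine ⟨energy_ne_top hU, fun V hV => ?_⟩
  have hTV := totalVar_lt_top_of_energy_ne_top hV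
  -- Green for -z leaves, in -⟪W, V⟫, the boundary terms z(0)(γV - V)(0) and -z(L)(γV - V)(L). As
  -- |z| ≤ 1, these are absorbed by the boundary part of E(V).
  have hgreen := integral_mul_deriv_le_totalVar_add_trace hL (integrableOn_fst V) hTV hz.neg
    (fun x => by simpa using hz1 x)
  have hint : ∫ x in Ioo 0 L, W.fst x * V.fst x
      = -∫ x in Ioo 0 L, V.fst x * deriv (-z) x := by
    rw [← integral_neg]
    refine integral_congr_ae (hW.mono fun x hx => ?_)
    simp only [hx, deriv.neg]
    ring
  rw [inner_sub_right, inner_neg_left, inner_neg_left, inner_H W V, hint, hW0, hW1,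
    toReal_energy hTV]
  simp only [Pi.neg_apply] at hgreen
  have h0 : z 0 * (trace L V.fst 0 - V.snd 0) ≤ |trace L V.fst 0 - V.snd 0| := by
    refine (le_abs_self _).trans ?_
    rw [abs_mul]; exact mul_le_of_le_one_left (abs_nonneg _) (hz1 0)
  have h1 : -z L * (trace L V.fst 1 - V.snd 1) ≤ |trace L V.fst 1 - V.snd 1| := by
    refine (le_abs_self _).trans ?_
    rw [abs_mul, abs_neg]; exact mul_le_of_le_one_left (abs_nonneg _) (hz1 L)
  linarith

/-- The element of `H` with components `P` and `v`. -/
def mkH (L : ℝ) (P : Lp ℝ 2 (volume.restrict (Ioo 0 L))) (v : Fin 2 → ℝ) : H L :=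
  (WithLp.prodContinuousLinearEquiv 2 ℝ _ _).symm (P, (EuclideanSpace.equiv (Fin 2) ℝ).symm v)

theorem hasDerivWithinAt_mkH {P : ℝ → Lp ℝ 2 (volume.restrict (Ioo 0 L))} {v : ℝ → Fin 2 → ℝ}
    {P' : Lp ℝ 2 (volume.restrict (Ioo 0 L))} {v' : Fin 2 → ℝ} {S : Set ℝ} {t : ℝ}
    (hP : HasDerivWithinAt P P' S t) (hv : ∀ i, HasDerivWithinAt (fun s => v s i) (v' i) S t) :
    HasDerivWithinAt (fun s => mkH L (P s) (v s)) (mkH L P' v') S t := by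
  have h1 := (EuclideanSpace.equiv (Fin 2) ℝ).symm.hasFDerivAt.comp_hasDerivWithinAt t
    (hasDerivWithinAt_pi.2 hv)
  exact (WithLp.prodContinuousLinearEquiv 2 ℝ (Lp ℝ 2 (volume.restrict (Ioo 0 L)))
    (EuclideanSpace ℝ (Fin 2))).symm.hasFDerivAt.comp_hasDerivWithinAt t (hP.prodMk h1)

theorem exists_lipschitzWith_mkH {P : ℝ → Lp ℝ 2 (volume.restrict (Ioo 0 L))}
    {v : ℝ → Fin 2 → ℝ} {C D : ℝ≥0} (hP : LipschitzWith C P)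
    (hv : ∀ i, LipschitzWith D fun s => v s i) :
    ∃ K, LipschitzWith K fun s => mkH L (P s) (v s) :=
  ⟨_, (WithLp.prodContinuousLinearEquiv 2 ℝ (Lp ℝ 2 (volume.restrict (Ioo 0 L)))
    (EuclideanSpace ℝ (Fin 2))).symm.lipschitz.comp (hP.prodMk
      ((EuclideanSpace.equiv (Fin 2) ℝ).symm.lipschitz.comp (LipschitzWith.of_dist_le_mul
        fun s t => (dist_pi_le_iff (by positivity)).2 fun i => (hv i).dist_le_mul s t)))⟩

theorem exists_lipschitzWith_toLp {α : Type*} [MeasurableSpace α] {μ : Measure α}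
    [IsFiniteMeasure μ] {f : ℝ → α → ℝ} (hf : ∀ t, MemLp (f t) 2 μ) {C : ℝ≥0}
    (hC : ∀ s t x, |f s x - f t x| ≤ C * |s - t|) :
    ∃ K, LipschitzWith K fun s => (hf s).toLp (f s) := by
  refine ⟨(measureUnivNNReal μ ^ ((2 : ℝ≥0∞).toReal)⁻¹) * C,
    LipschitzWith.of_dist_le_mul fun s t => ?_⟩
  rw [dist_eq_norm, ← MemLp.toLp_sub, NNReal.coe_mul, mul_assoc]
  refine Lp.norm_le_of_ae_bound (by rw [Real.dist_eq]; positivity) ?_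
  filter_upwards [((hf s).sub (hf t)).coeFn_toLp] with x hx
  rw [hx]
  exact hC s t x

theorem H_ext {U V : H L} (h1 : U.fst =ᵐ[volume.restrict (Ioo 0 L)] V.fst)
    (h2 : ∀ i, U.snd i = V.snd i) : U = V := by
  refine (WithLp.prodContinuousLinearEquiv 2 ℝ (Lp ℝ 2 (volume.restrict (Ioo 0 L)))
    (EuclideanSpace ℝ (Fin 2))).injective (Prod.ext (Lp.ext h1) ?_)
  ext i
  exact h2 i

end EnergySpace

/-! ### Profile, velocity and calibrating field -/

/-- The evolving increasing profile: `f` truncated at the facet heights, stopped at time `T`. -/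
def profile (f hl hr : ℝ → ℝ) (T t x : ℝ) : ℝ :=
  max (hl (min t T)) (min (hr (min t T)) (f x))

/-- The velocity of the profile. -/
def velocity (L χ : ℝ) (a b : ℝ → ℝ) (t : ℝ) : ℝ → ℝ :=
  threePiece (a t) (b t) (χ / (1 + a t)) (-χ / (1 + L - b t)) fun _ => 0

/-- The calibrating field of the increasing profile with facets `[0, a]` and `[b, L]`. -/
def field (L a b x : ℝ) : ℝ :=
  1 - max 0 (a - max 0 x) / (1 + a) - max 0 (min L x - b) / (1 + L - b)

theorem exists_lipschitzWith_field (L a b : ℝ) :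
    ∃ K, LipschitzWith K (field L a b) := by
  have h1 : LipschitzWith 1 fun x : ℝ => max 0 (a - max 0 x) := by
    have := ((LipschitzWith.const a).sub ((LipschitzWith.id (α := ℝ)).const_max 0)).const_max 0
    simpa using this
  have h2 : LipschitzWith 1 fun x : ℝ => max 0 (min L x - b) := by
    have := (((LipschitzWith.id (α := ℝ)).const_min L).sub (LipschitzWith.const b)).const_max 0
    simpa using this
  have h3 := (lipschitzWith_smul (1 + a)⁻¹).comp h1
  have h4 := (lipschitzWith_smul (1 + L - b)⁻¹).comp h2
  have e : field L a b = fun x =>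
      1 - (1 + a)⁻¹ • max 0 (a - max 0 x) - (1 + L - b)⁻¹ • max 0 (min L x - b) := by
    funext x; simp [field, div_eq_inv_mul]
  rw [e]
  exact ⟨_, ((LipschitzWith.const (1 : ℝ)).sub h3).sub h4⟩

/-- Since a ≤ b, at most one of the two corrections is nonzero at x. Clamping x to [0, L] keeps each
of them in [0, 1] on the whole line, as the Green inequality demands. -/
theorem abs_field_le {L a b : ℝ} (ha : 0 ≤ a) (hab : a ≤ b) (hbL : b < L) (x : ℝ) :
    |field L a b x| ≤ 1 := by
  have p1 : 0 < 1 + a := by linarith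
  have p2 : 0 < 1 + L - b := by linarith
  have h1 : max 0 (a - max 0 x) / (1 + a) ≤ 1 := by
    rw [div_le_one p1]
    exact max_le p1.le (by linarith [le_max_left 0 x])
  have h2 : max 0 (min L x - b) / (1 + L - b) ≤ 1 := by
    rw [div_le_one p2]
    exact max_le p2.le (by linarith [min_le_left L x])
  have h1' : 0 ≤ max 0 (a - max 0 x) / (1 + a) := div_nonneg (le_max_left _ _) p1.le
  have h2' : 0 ≤ max 0 (min L x - b) / (1 + L - b) := div_nonneg (le_max_left _ _) p2.le
  rw [abs_le, field]
  rcases le_total x b with h | h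
  · have : max 0 (min L x - b) = 0 := max_eq_left (by linarith [min_le_right L x])
    rw [this, zero_div] at *
    constructor <;> linarith
  · have : max 0 (a - max 0 x) = 0 := max_eq_left (by linarith [le_max_right 0 x])
    rw [this, zero_div] at *
    constructor <;> linarith

theorem field_zero {L a b : ℝ} (ha : 0 ≤ a) (hb : 0 ≤ b) (hL : 0 < L) :
    field L a b 0 = 1 / (1 + a) := by
  have p1 : 1 + a ≠ 0 := by linarith
  rw [field, max_self, sub_zero, max_eq_right ha, min_eq_right hL.le, max_eq_left (by linarith)]
  field_simp
  ring

theorem field_right {L a b : ℝ} (haL : a ≤ L) (hL : 0 < L) (hbL : b < L) :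
    field L a b L = 1 / (1 + L - b) := by
  have p2 : 1 + L - b ≠ 0 := by linarith
  rw [field, max_eq_right hL.le, max_eq_left (by linarith), min_self,
    max_eq_right (by linarith : 0 ≤ L - b)]
  field_simp
  ring

/-- The divergence of the calibrating field is the velocity of the profile, which links the geometry
to the evolution. -/
theorem hasDerivAt_field {L a b χ x : ℝ} (hab : a ≤ b) (hx : x ∈ Ioo 0 L)
    (hxa : x ≠ a) (hxb : x ≠ b) :
    HasDerivAt (fun x => χ * field L a b x)
      (threePiece a b (χ / (1 + a)) (-χ / (1 + L - b)) (fun _ => 0) x) x := by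
  have hev : ∀ᶠ y in 𝓝 x, y ∈ Ioo 0 L := Ioo_mem_nhds hx.1 hx.2
  rcases lt_or_gt_of_ne hxa with h | h
  · rw [threePiece, if_pos h.le]
    have : (fun x => χ * field L a b x) =ᶠ[𝓝 x] fun y => χ * (1 - (a - y) / (1 + a)) := by
      filter_upwards [hev, Iio_mem_nhds h] with y hy hya
      have hya : y < a := hya
      rw [field, max_eq_right hy.1.le, max_eq_right (by linarith), min_eq_right hy.2.le,
        max_eq_left (by linarith)]
      simp
    rw [this.hasDerivAt_iff]
    have := ((((hasDerivAt_id x).const_sub a).div_const (1 + a)).const_sub 1).const_mul χ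
    refine this.congr_deriv ?_
    ring
  rcases lt_or_gt_of_ne hxb with h' | h'
  · rw [threePiece, if_neg h.not_ge, if_pos h']
    have : (fun x => χ * field L a b x) =ᶠ[𝓝 x] fun y => χ * 1 := by
      filter_upwards [hev, Ioi_mem_nhds h, Iio_mem_nhds h'] with y hy hya hyb
      have hya : a < y := hya
      have hyb : y < b := hyb
      rw [field, max_eq_right hy.1.le, max_eq_left (by linarith), min_eq_right hy.2.le,
        max_eq_left (by linarith)]
      simp
    rw [this.hasDerivAt_iff]
    exact hasDerivAt_const _ _
  · rw [threePiece, if_neg h.not_ge, if_neg h'.not_gt]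
    have : (fun x => χ * field L a b x) =ᶠ[𝓝 x] fun y => χ * (1 - (y - b) / (1 + L - b)) := by
      filter_upwards [hev, Ioi_mem_nhds h'] with y hy hyb
      have hyb : b < y := hyb
      rw [field, max_eq_right hy.1.le, max_eq_left (by linarith), min_eq_right hy.2.le,
        max_eq_right (by linarith)]
      simp
    rw [this.hasDerivAt_iff]
    have := ((((hasDerivAt_id x).sub_const b).div_const (1 + L - b)).const_sub 1).const_mul χ
    refine this.congr_deriv ?_
    ring

theorem ae_ne_restrict (c : ℝ) (S : Set ℝ) : ∀ᵐ x ∂volume.restrict S, x ≠ c :=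
  ae_restrict_of_ae (by simp [ae_iff, measure_singleton])

theorem measurable_threePiece_zero (a b c₁ c₂ : ℝ) :
    Measurable (threePiece a b c₁ c₂ fun _ => 0) :=
  Measurable.ite measurableSet_Iic measurable_const
    (Measurable.ite measurableSet_Iio measurable_const measurable_const)

theorem integral_threePiece_zero {L a b c₁ c₂ : ℝ} (ha : 0 ≤ a) (hab : a ≤ b) (hbL : b ≤ L) :
    ∫ x in Ioo 0 L, threePiece a b c₁ c₂ (fun _ => 0) x = a * c₁ + (L - b) * c₂ := by
  have hae : threePiece a b c₁ c₂ (fun _ => 0) =ᵐ[volume.restrict (Ioo 0 L)]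
      fun x => (Ioo 0 a).indicator (fun _ => c₁) x + (Ioo b L).indicator (fun _ => c₂) x := by
    filter_upwards [ae_ne_restrict a _, ae_ne_restrict b _, ae_restrict_mem measurableSet_Ioo]
      with x h1 h2 hx
    rcases lt_or_gt_of_ne h1 with h | h
    · rw [threePiece, if_pos h.le, indicator_of_mem (show x ∈ Ioo 0 a from ⟨hx.1, h⟩),
        indicator_of_notMem (fun h' : x ∈ Ioo b L => by linarith [h'.1]), add_zero]
    rw [threePiece, if_neg h.not_ge, indicator_of_notMem (fun h' : x ∈ Ioo 0 a => h'.2.not_gt h),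
      zero_add]
    rcases lt_or_gt_of_ne h2 with h' | h'
    · rw [if_pos h', indicator_of_notMem (fun h'' : x ∈ Ioo b L => h''.1.not_gt h')]
    · rw [if_neg h'.not_gt, indicator_of_mem (show x ∈ Ioo b L from ⟨h', hx.2⟩)]
  rw [integral_congr_ae hae, integral_add
    ((integrable_const _).indicator measurableSet_Ioo)
    ((integrable_const _).indicator measurableSet_Ioo),
    setIntegral_indicator measurableSet_Ioo, setIntegral_indicator measurableSet_Ioo,
    inter_eq_right.2 (Ioo_subset_Ioo_right (hab.trans hbL)),
    inter_eq_right.2 (Ioo_subset_Ioo_left (ha.trans hab)), setIntegral_const, setIntegral_const,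
    measureReal_def, measureReal_def, Real.volume_Ioo, Real.volume_Ioo, sub_zero,
    ENNReal.toReal_ofReal ha, ENNReal.toReal_ofReal (by linarith), smul_eq_mul, smul_eq_mul]

theorem abs_velocity_le {L χ : ℝ} (hχ : |χ| = 1) {a b : ℝ → ℝ} {t : ℝ} (ha : 0 ≤ a t)
    (hb : b t ≤ L) (x : ℝ) : |velocity L χ a b t x| ≤ 1 := by
  have h1 : |χ / (1 + a t)| ≤ 1 := by
    rw [abs_div, hχ, abs_of_pos (by linarith), div_le_one (by linarith)]; linarith
  have h2 : |-χ / (1 + L - b t)| ≤ 1 := by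
    rw [abs_div, abs_neg, hχ, abs_of_pos (by linarith), div_le_one (by linarith)]; linarith
  unfold velocity threePiece
  split_ifs
  · exact h1
  · simp
  · exact h2

/-! ### Verification of the explicit flow -/

/-- An increasing Lipschitz profile `f`, flat on `[β, L]`, with its facet motion. -/
structure FlowData (L β χ : ℝ) (f : ℝ → ℝ) (K : ℝ≥0) (T : ℝ) (a b hl hr : ℝ → ℝ) : Prop
    extends FacetMotion L β f T a b hl hr where
  β_pos : 0 < β
  β_lt : β < L
  lip : LipschitzOnWith K f (Icc 0 L)
  mono : StrictMonoOn f (Icc 0 β)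
  flat : ∀ x ∈ Icc β L, f x = f L
  sign : χ = 1 ∨ χ = -1

namespace FlowData

variable {L β χ : ℝ} {f : ℝ → ℝ} {K : ℝ≥0} {T : ℝ} {a b hl hr : ℝ → ℝ}
  (D : FlowData L β χ f K T a b hl hr)

include D

theorem L_pos : 0 < L := D.β_pos.trans D.β_lt

theorem abs_sign : |χ| = 1 := by rcases D.sign with h | h <;> simp [h]

theorem sign_sq : χ * χ = 1 := by rcases D.sign with h | h <;> simp [h]

theorem b_lt (t : ℝ) : b t < L := (D.b_mem t).2.trans_lt D.β_lt

theorem monotoneOn : MonotoneOn f (Icc 0 L) := by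
  have hβ : β ∈ Icc 0 β := ⟨D.β_pos.le, le_rfl⟩
  intro x hx y hy hxy
  rcases le_total y β with h | h
  · exact D.mono.monotoneOn ⟨hx.1, hxy.trans h⟩ ⟨hy.1, h⟩ hxy
  · rw [D.flat y ⟨h, hy.2⟩, ← D.flat β ⟨le_rfl, D.β_lt.le⟩]
    rcases le_total x β with h' | h'
    · exact D.mono.monotoneOn ⟨hx.1, h'⟩ hβ h'
    · rw [D.flat x ⟨h', hx.2⟩, ← D.flat β ⟨le_rfl, D.β_lt.le⟩]

theorem hl_lt_hr {t : ℝ} (ht : t < T) : hl t < hr t :=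
  (D.hl_mono ht).trans (D.meet_height.trans_lt (D.hr_anti ht))

theorem hl_le_hr {t : ℝ} (ht : t ≤ T) : hl t ≤ hr t := by
  rcases ht.eq_or_lt with rfl | h
  · exact D.meet_height.le
  · exact (D.hl_lt_hr h).le

theorem a_lt_b {t : ℝ} (ht : t ∈ Ico 0 T) : a t < b t := by
  refine (D.mono.lt_iff_lt (D.a_mem t) (D.b_mem t)).1 ?_
  rw [D.f_a t ⟨ht.1, ht.2.le⟩, D.f_b t ⟨ht.1, ht.2.le⟩]
  exact D.hl_lt_hr ht.2

theorem a_pos {t : ℝ} (ht : t ∈ Ioc 0 T) : 0 < a t := by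
  refine (D.mono.lt_iff_lt ⟨le_rfl, D.β_pos.le⟩ (D.a_mem t)).1 ?_
  rw [D.f_a t ⟨ht.1.le, ht.2⟩, ← D.hl_zero]
  exact D.hl_mono ht.1

theorem lipschitzWith_hl : LipschitzWith 1 hl := by
  refine lipschitzWith_of_nnnorm_deriv_le (fun t => (D.hl_deriv t).differentiableAt) fun t => ?_
  have := (D.a_mem t).1
  rw [(D.hl_deriv t).deriv, ← NNReal.coe_le_coe, coe_nnnorm, NNReal.coe_one,
    Real.norm_of_nonneg (by positivity), div_le_one (by positivity)]
  linarith

theorem lipschitzWith_hr : LipschitzWith 1 hr := by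
  refine lipschitzWith_of_nnnorm_deriv_le (fun t => (D.hr_deriv t).differentiableAt) fun t => ?_
  have := D.b_lt t
  have h1 : 0 < 1 + L - b t := by linarith
  rw [(D.hr_deriv t).deriv, ← NNReal.coe_le_coe, coe_nnnorm, NNReal.coe_one, norm_neg,
    Real.norm_of_nonneg (by positivity), div_le_one (by positivity)]
  linarith

theorem lipschitzWith_stopped {h : ℝ → ℝ} (hh : LipschitzWith 1 h) (S : ℝ) :
    LipschitzWith 1 fun t => χ * h (min t S) := by
  refine LipschitzWith.of_dist_le_mul fun s t => ?_
  rw [Real.dist_eq, ← mul_sub, abs_mul, D.abs_sign, one_mul, ← Real.dist_eq]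
  have := (hh.comp ((LipschitzWith.id (α := ℝ)).min_const S)).dist_le_mul s t
  simpa using this

/-- `max` and `min` are nonexpansive, so the profile moves no faster than its truncation heights,
whose speeds are at most 1. -/
theorem abs_profile_sub_le (s t x : ℝ) :
    |χ * profile f hl hr T s x - χ * profile f hl hr T t x| ≤ 1 * |s - t| := by
  have h1 := (D.lipschitzWith_hl.comp ((LipschitzWith.id (α := ℝ)).min_const T)).dist_le_mul s t
  have h2 := (D.lipschitzWith_hr.comp ((LipschitzWith.id (α := ℝ)).min_const T)).dist_le_mul s t
  simp only [Function.comp, id, Real.dist_eq, mul_one, NNReal.coe_one] at h1 h2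
  rw [← mul_sub, abs_mul, D.abs_sign, one_mul]
  unfold profile
  refine (abs_max_sub_max_le_max _ _ _ _).trans (max_le h1 ?_)
  refine (abs_min_sub_min_le_max _ _ _ _).trans (max_le h2 ?_)
  rw [sub_self, abs_zero]
  positivity

theorem lipschitzOnWith_profile (t : ℝ) :
    LipschitzOnWith K (profile f hl hr T t) (Icc 0 L) := by
  refine LipschitzOnWith.of_dist_le_mul fun x hx y hy => ?_
  refine le_trans ?_ (D.lip.dist_le_mul x hx y hy)
  rw [Real.dist_eq, Real.dist_eq]
  unfold profile
  refine (abs_max_sub_max_le_max _ _ _ _).trans (max_le (by simp) ?_)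
  exact (abs_min_sub_min_le_max _ _ _ _).trans (max_le (by simp) le_rfl)

theorem monotoneOn_profile (t : ℝ) : MonotoneOn (profile f hl hr T t) (Icc 0 L) :=
  fun _ hx _ hy hxy => max_le_max le_rfl (min_le_min le_rfl (D.monotoneOn hx hy hxy))

theorem memLp_profile (t : ℝ) :
    MemLp (fun x => χ * profile f hl hr T t x) 2 (volume.restrict (Ioo 0 L)) := by
  have hc := continuousOn_const (c := χ).mul (D.lipschitzOnWith_profile t).continuousOn
  obtain ⟨C, hC⟩ := isCompact_Icc.exists_bound_of_continuousOn hc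
  refine MemLp.of_bound ((hc.mono Ioo_subset_Icc_self).aestronglyMeasurable measurableSet_Ioo) C ?_
  filter_upwards [ae_restrict_mem measurableSet_Ioo] with x hx
  exact hC x (Ioo_subset_Icc_self hx)

theorem memLp_velocity (t : ℝ) :
    MemLp (velocity L χ a b t) 2 (volume.restrict (Ioo 0 L)) :=
  MemLp.of_bound (measurable_threePiece_zero _ _ _ _).aestronglyMeasurable 1
    (Eventually.of_forall (abs_velocity_le D.abs_sign (D.a_mem t).1 (D.b_lt t).le))

theorem stopped_mem {t : ℝ} (ht : 0 ≤ t) : min t T ∈ Icc 0 T :=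
  ⟨le_min ht D.time_pos.le, min_le_right _ _⟩

theorem profile_left {t : ℝ} (ht : 0 ≤ t) : profile f hl hr T t 0 = hl (min t T) := by
  refine max_eq_left ((min_le_right _ _).trans ?_)
  rw [← D.hl_zero]
  exact D.hl_mono.monotone (D.stopped_mem ht).1

theorem profile_right {t : ℝ} (ht : 0 ≤ t) : profile f hl hr T t L = hr (min t T) := by
  have : hr (min t T) ≤ f L := by
    rw [← D.flat β ⟨le_rfl, D.β_lt.le⟩, ← D.hr_zero]
    exact D.hr_anti.antitone (D.stopped_mem ht).1
  rw [profile, min_eq_left this]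
  exact max_eq_right (D.hl_le_hr (min_le_right _ _))

/-- By monotonicity, truncating f at the heights f(a) and f(b) amounts to cutting at the positions a
and b. -/
theorem profile_eq_threePiece {t x : ℝ} (ht : t ∈ Icc 0 T) (hx : x ∈ Icc 0 L) :
    profile f hl hr T t x = threePiece (a t) (b t) (hl t) (hr t) f x := by
  have hle := D.hl_le_hr ht.2
  have haL : a t ∈ Icc 0 L := ⟨(D.a_mem t).1, (D.a_mem t).2.trans D.β_lt.le⟩
  have hbL : b t ∈ Icc 0 L := ⟨(D.b_mem t).1, (D.b_lt t).le⟩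
  rw [profile, min_eq_left ht.2, threePiece]
  split_ifs with h1 h2
  · refine max_eq_left ((min_le_right _ _).trans ?_)
    rw [← D.f_a t ht]; exact D.monotoneOn hx haL h1
  · have h3 : hl t ≤ f x := by
      rw [← D.f_a t ht]; exact D.monotoneOn haL hx (le_of_not_ge h1)
    have h4 : f x ≤ hr t := by
      rw [← D.f_b t ht]; exact D.monotoneOn hx hbL h2.le
    rw [min_eq_right h4, max_eq_right h3]
  · have h4 : hr t ≤ f x := by
      rw [← D.f_b t ht]; exact D.monotoneOn hbL hx (le_of_not_gt h2)
    rw [min_eq_left h4, max_eq_right hle]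

theorem hasDerivWithinAt_profile {t x : ℝ} (ht : t ∈ Ico 0 T) (hx : x ∈ Ioo 0 L)
    (hxa : x ≠ a t) (hxb : x ≠ b t) :
    HasDerivWithinAt (fun s => χ * profile f hl hr T s x) (velocity L χ a b t x) (Ici t) t := by
  have htT : t ∈ Icc 0 T := ⟨ht.1, ht.2.le⟩
  have hlc : Continuous hl := D.lipschitzWith_hl.continuous
  have hrc : Continuous hr := D.lipschitzWith_hr.continuous
  have hev : ∀ᶠ s in 𝓝[≥] t, min s T = s ∧ hl s < hr s ∧ t ≤ s := by
    filter_upwards [self_mem_nhdsWithin, nhdsWithin_le_nhds (Iio_mem_nhds ht.2)] with s h1 h2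
    exact ⟨min_eq_left (le_of_lt h2), D.hl_lt_hr h2, h1⟩
  have haL : a t ∈ Icc 0 L := ⟨(D.a_mem t).1, (D.a_mem t).2.trans D.β_lt.le⟩
  have hbL : b t ∈ Icc 0 L := ⟨(D.b_mem t).1, (D.b_lt t).le⟩
  have hxL := Ioo_subset_Icc_self hx
  have hab := D.a_lt_b ht
  unfold velocity threePiece
  rcases lt_or_gt_of_ne hxa with h | h
  · rw [if_pos h.le]
    have hfx : f x < hl t := by
      rw [← D.f_a t htT]
      exact D.mono ⟨hx.1.le, h.le.trans (D.a_mem t).2⟩ (D.a_mem t) h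
    have hd : HasDerivWithinAt (fun s => χ * hl s) (χ / (1 + a t)) (Ici t) t := by
      rw [div_eq_mul_one_div]
      exact ((D.hl_deriv t).const_mul χ).hasDerivWithinAt
    refine hd.congr_of_eventuallyEq_of_mem ?_ self_mem_Ici
    filter_upwards [hev, nhdsWithin_le_nhds (hlc.continuousAt.eventually_const_lt hfx)] with s h1 h2
    rw [profile, h1.1, max_eq_left ((min_le_right _ _).trans h2.le)]
  rw [if_neg h.not_ge]
  rcases lt_or_gt_of_ne hxb with h' | h'
  · rw [if_pos h']
    have h1 : hl t < f x := by
      rw [← D.f_a t htT]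
      exact D.mono (D.a_mem t) ⟨hx.1.le, h'.le.trans (D.b_mem t).2⟩ h
    have h2 : f x < hr t := by
      rw [← D.f_b t htT]
      exact D.mono ⟨hx.1.le, h'.le.trans (D.b_mem t).2⟩ (D.b_mem t) h'
    refine (hasDerivWithinAt_const t (Ici t) (χ * f x)).congr_of_eventuallyEq_of_mem ?_ self_mem_Ici
    filter_upwards [hev, nhdsWithin_le_nhds (hlc.continuousAt.eventually_lt_const h1),
      nhdsWithin_le_nhds (hrc.continuousAt.eventually_const_lt h2)] with s h1 h2 h3
    rw [profile, h1.1, min_eq_right h3.le, max_eq_right h2.le]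
  · rw [if_neg h'.not_gt]
    -- Equality occurs at t = 0, on the initial flat part. The right height decreases, so the
    -- inequality persists for s ≥ t; this is where a right derivative is essential.
    have hfx : hr t ≤ f x := by
      rw [← D.f_b t htT]; exact D.monotoneOn hbL hxL h'.le
    have hd : HasDerivWithinAt (fun s => χ * hr s) (-χ / (1 + L - b t)) (Ici t) t := by
      rw [show -χ / (1 + L - b t) = χ * -(1 / (1 + L - b t)) by ring]
      exact ((D.hr_deriv t).const_mul χ).hasDerivWithinAt
    refine hd.congr_of_eventuallyEq_of_mem ?_ self_mem_Ici
    filter_upwards [hev] with s h1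
    rw [profile, h1.1, min_eq_left ((D.hr_anti.antitone h1.2.2).trans hfx),
      max_eq_right h1.2.1.le]

/-- The solution: the truncated profile together with its boundary values. -/
def flow (t : ℝ) : H L :=
  mkH L ((D.memLp_profile t).toLp _) ![χ * hl (min t T), χ * hr (min t T)]

/-- The velocity of the solution before the facets meet. -/
def flowVelocity (t : ℝ) : H L :=
  mkH L ((D.memLp_velocity t).toLp _) ![χ / (1 + a t), -χ / (1 + L - b t)]

theorem flow_fst (t : ℝ) : (D.flow t).fst =ᵐ[volume.restrict (Ioo 0 L)]
    fun x => χ * profile f hl hr T t x := (D.memLp_profile t).coeFn_toLp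

theorem flow_snd_zero (t : ℝ) : (D.flow t).snd 0 = χ * hl (min t T) := rfl

theorem flow_snd_one (t : ℝ) : (D.flow t).snd 1 = χ * hr (min t T) := rfl

theorem flowVelocity_fst (t : ℝ) : (D.flowVelocity t).fst =ᵐ[volume.restrict (Ioo 0 L)]
    velocity L χ a b t := (D.memLp_velocity t).coeFn_toLp

theorem flowVelocity_snd_zero (t : ℝ) : (D.flowVelocity t).snd 0 = χ / (1 + a t) := rfl

theorem flowVelocity_snd_one (t : ℝ) : (D.flowVelocity t).snd 1 = -χ / (1 + L - b t) := rfl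

theorem exists_lipschitzWith_flow : ∃ C, LipschitzWith C D.flow := by
  obtain ⟨C, hC⟩ := exists_lipschitzWith_toLp D.memLp_profile (C := 1)
    (fun s t x => D.abs_profile_sub_le s t x)
  refine exists_lipschitzWith_mkH (D := 1) hC fun i => ?_
  fin_cases i
  · exact D.lipschitzWith_stopped D.lipschitzWith_hl T
  · exact D.lipschitzWith_stopped D.lipschitzWith_hr T

theorem hasDerivWithinAt_flow {t : ℝ} (ht : t ∈ Ico 0 T) :
    HasDerivWithinAt D.flow (D.flowVelocity t) (Ici t) t := by
  refine hasDerivWithinAt_mkH ?_ fun i => ?_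
  · refine hasDerivWithinAt_memLp_toLp D.memLp_profile (C := 1)
      (fun s x => D.abs_profile_sub_le s t x) (D.memLp_velocity t)
      (abs_velocity_le D.abs_sign (D.a_mem t).1 (D.b_lt t).le) ?_
    filter_upwards [ae_ne_restrict (a t) _, ae_ne_restrict (b t) _,
      ae_restrict_mem measurableSet_Ioo] with x h1 h2 hx
    exact D.hasDerivWithinAt_profile ht hx h1 h2
  · have hev : ∀ᶠ s in 𝓝[≥] t, min s T = s :=
      nhdsWithin_le_nhds
        (Filter.mem_of_superset (Iio_mem_nhds ht.2) fun s hs => min_eq_left (le_of_lt hs))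
    fin_cases i
    · have hd : HasDerivWithinAt (fun s => χ * hl s) (χ / (1 + a t)) (Ici t) t := by
        rw [div_eq_mul_one_div]
        exact ((D.hl_deriv t).const_mul χ).hasDerivWithinAt
      refine hd.congr_of_eventuallyEq_of_mem ?_ self_mem_Ici
      filter_upwards [hev] with s hs
      simp [hs]
    · have hd : HasDerivWithinAt (fun s => χ * hr s) (-χ / (1 + L - b t)) (Ici t) t := by
        rw [show -χ / (1 + L - b t) = χ * -(1 / (1 + L - b t)) by ring]
        exact ((D.hr_deriv t).const_mul χ).hasDerivWithinAt
      refine hd.congr_of_eventuallyEq_of_mem ?_ self_mem_Ici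
      filter_upwards [hev] with s hs
      simp [hs]

theorem flow_eq_of_ge {t : ℝ} (ht : T ≤ t) : D.flow t = D.flow T := by
  have h : min t T = min T T := by rw [min_eq_right ht, min_self]
  refine H_ext ?_ fun i => ?_
  · filter_upwards [D.flow_fst t, D.flow_fst T] with x h1 h2
    rw [h1, h2, profile, profile, h]
  · fin_cases i
    · show χ * hl (min t T) = χ * hl (min T T)
      rw [h]
    · show χ * hr (min t T) = χ * hr (min T T)
      rw [h]

theorem hasDerivWithinAt_flow_of_ge {t : ℝ} (ht : T ≤ t) :
    HasDerivWithinAt D.flow 0 (Ici t) t :=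
  (hasDerivWithinAt_const t (Ici t) (D.flow T)).congr
    (fun _ hs => D.flow_eq_of_ge (ht.trans hs)) (D.flow_eq_of_ge ht)

theorem totalVar_flow_le {t : ℝ} (ht : 0 ≤ t) :
    totalVar L (D.flow t).fst ≤ ENNReal.ofReal (hr (min t T) - hl (min t T)) := by
  rw [totalVar_congr (D.flow_fst t), ← D.profile_left ht, ← D.profile_right ht]
  exact totalVar_le_of_monotoneOn D.L_pos D.abs_sign (D.lipschitzOnWith_profile t)
    (D.monotoneOn_profile t)

theorem hasTrace_flow {t : ℝ} (ht : 0 ≤ t) (i : Fin 2) :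
    HasTrace L (D.flow t).fst i ((D.flow t).snd i) := by
  refine hasTrace_congr D.L_pos (D.flow_fst t) (hasTrace_of_tendsto D.L_pos
    ((D.memLp_profile t).integrable (by norm_num)) ?_)
  have hmem : endpt L i ∈ Icc 0 L := by
    fin_cases i <;> simp [endpt, D.L_pos.le]
  have hval : (D.flow t).snd i = χ * profile f hl hr T t (endpt L i) := by
    fin_cases i
    · show χ * hl (min t T) = χ * profile f hl hr T t 0
      rw [D.profile_left ht]
    · show χ * hr (min t T) = χ * profile f hl hr T t L
      rw [D.profile_right ht]
  rw [hval]
  exact ((continuousOn_const (c := χ).mul (D.lipschitzOnWith_profile t).continuousOn)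
    _ hmem).mono Ioo_subset_Icc_self

theorem toReal_energy_flow_le {t : ℝ} (ht : 0 ≤ t) :
    (energy L (D.flow t)).toReal ≤ hr (min t T) - hl (min t T) := by
  have hfin := (D.totalVar_flow_le ht).trans_lt ENNReal.ofReal_lt_top
  have htr : ∀ i, trace L (D.flow t).fst i = (D.flow t).snd i := fun i =>
    (D.hasTrace_flow ht i).limUnder_eq
  rw [toReal_energy hfin, htr, htr]
  simp only [sub_self, abs_zero, add_zero]
  exact ENNReal.toReal_le_of_le_ofReal
    (sub_nonneg.2 (D.hl_le_hr (min_le_right _ _))) (D.totalVar_flow_le ht)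

/-- On the left facet, length a plus boundary mass 1 times speed 1/(1 + a) gives weight exactly 1 to
its height; the right facet gives weight -1. The middle part does not move. -/
theorem inner_flowVelocity_flow {t : ℝ} (ht : t ∈ Ico 0 T) :
    ⟪D.flowVelocity t, D.flow t⟫_ℝ = hl t - hr t := by
  have ha := (D.a_mem t).1
  have hb := D.b_lt t
  have hab := D.a_lt_b ht
  have hint : ∫ x in Ioo 0 L, (D.flowVelocity t).fst x * (D.flow t).fst x
      = a t * (1 / (1 + a t) * hl t) + (L - b t) * (-(1 / (1 + L - b t)) * hr t) := by
    rw [← integral_threePiece_zero ha hab.le hb.le]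
    refine integral_congr_ae ?_
    filter_upwards [D.flowVelocity_fst t, D.flow_fst t, ae_restrict_mem measurableSet_Ioo]
      with x h1 h2 hx
    rw [h1, h2, D.profile_eq_threePiece ⟨ht.1, ht.2.le⟩ (Ioo_subset_Icc_self hx)]
    unfold velocity threePiece
    have hs := D.sign_sq
    split_ifs
    · linear_combination (1 / (1 + a t) * hl t) * hs
    · ring
    · linear_combination (-(1 / (1 + L - b t)) * hr t) * hs
  rw [inner_H, hint, D.flowVelocity_snd_zero, D.flowVelocity_snd_one, D.flow_snd_zero,
    D.flow_snd_one, min_eq_left ht.2.le]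
  have p1 : 1 + a t ≠ 0 := by linarith
  have p2 : 1 + L - b t ≠ 0 := by linarith
  have e1 : χ / (1 + a t) * (χ * hl t) = 1 / (1 + a t) * hl t := by
    linear_combination (1 / (1 + a t) * hl t) * D.sign_sq
  have e2 : -χ / (1 + L - b t) * (χ * hr t) = -(1 / (1 + L - b t)) * hr t := by
    linear_combination (-(1 / (1 + L - b t)) * hr t) * D.sign_sq
  rw [e1, e2]
  field_simp
  ring

theorem neg_flowVelocity_mem {t : ℝ} (ht : t ∈ Ico 0 T) :
    -D.flowVelocity t ∈ subdifferential (energy L) (D.flow t) := by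
  have ha := (D.a_mem t).1
  have hb := D.b_lt t
  have hab := D.a_lt_b ht
  obtain ⟨C, hC⟩ := exists_lipschitzWith_field L (a t) (b t)
  refine neg_mem_subdifferential_energy D.L_pos (z := fun x => χ * field L (a t) (b t) x)
    ((lipschitzWith_smul χ).comp hC) (fun x => ?_) ?_ ?_ ?_
    ((D.totalVar_flow_le ht.1).trans_lt ENNReal.ofReal_lt_top) ?_
  · rw [abs_mul, D.abs_sign, one_mul]
    exact abs_field_le ha hab.le hb x
  · filter_upwards [D.flowVelocity_fst t, ae_ne_restrict (a t) _, ae_ne_restrict (b t) _,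
      ae_restrict_mem measurableSet_Ioo] with x h h1 h2 hx
    rw [h, (hasDerivAt_field hab.le hx h1 h2).deriv, velocity]
  · rw [D.flowVelocity_snd_zero, field_zero ha (D.b_mem t).1 D.L_pos, mul_one_div]
  · rw [D.flowVelocity_snd_one, field_right (hab.le.trans hb.le) D.L_pos hb, mul_one_div, neg_div]
  · rw [D.inner_flowVelocity_flow ht, neg_sub]
    have := D.toReal_energy_flow_le ht.1
    rwa [min_eq_left ht.2.le] at this

/-- Once the heights agree the energy is 0, its minimum, and the zero field is a certificate. -/
theorem neg_zero_mem_of_ge {t : ℝ} (ht : T ≤ t) :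
    -(0 : H L) ∈ subdifferential (energy L) (D.flow t) := by
  have ht0 := D.time_pos.le.trans ht
  refine neg_mem_subdifferential_energy D.L_pos (z := fun _ => 0) (LipschitzWith.const 0)
    (fun x => by simp) ?_ (by simp) (by simp)
    ((D.totalVar_flow_le ht0).trans_lt ENNReal.ofReal_lt_top) ?_
  · filter_upwards [Lp.coeFn_zero ℝ 2 (volume.restrict (Ioo 0 L))] with x hx
    rw [deriv_const]
    exact hx
  · have := D.toReal_energy_flow_le ht0
    rw [min_eq_right ht, D.meet_height, sub_self] at this
    rwa [inner_zero_left, neg_zero]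

theorem isGradientFlow_flow : IsGradientFlow (energy L) (D.flow 0) D.flow := by
  obtain ⟨C, hC⟩ := D.exists_lipschitzWith_flow
  refine isGradientFlow_of_hasDerivWithinAt hC fun t ht => ?_
  rcases lt_or_ge t T with h | h
  · exact ⟨_, D.hasDerivWithinAt_flow ⟨ht.le, h⟩, D.neg_flowVelocity_mem ⟨ht.le, h⟩⟩
  · exact ⟨0, D.hasDerivWithinAt_flow_of_ge h, D.neg_zero_mem_of_ge h⟩

/-- Time 0 must be excluded: there a = 0, so u_t vanishes near 0 while the boundary value moves with
velocity χ. For t > 0 the left facet has positive length and u_t is constant near each end. -/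
theorem hasTrace_flowVelocity {t : ℝ} (ht : t ∈ Ioo 0 T) (i : Fin 2) :
    HasTrace L (D.flowVelocity t).fst i ((D.flowVelocity t).snd i) := by
  refine hasTrace_congr D.L_pos (D.flowVelocity_fst t) (hasTrace_of_tendsto D.L_pos
    ((D.memLp_velocity t).integrable (by norm_num)) ?_)
  refine Tendsto.congr' ?_ tendsto_const_nhds
  fin_cases i
  · filter_upwards [nhdsWithin_le_nhds (Iio_mem_nhds (D.a_pos ⟨ht.1, ht.2.le⟩))] with x hx
    rw [velocity, threePiece, if_pos (le_of_lt hx)]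
    rfl
  · filter_upwards [nhdsWithin_le_nhds (Ioi_mem_nhds (D.b_lt t))] with x hx
    have hx' : b t < x := hx
    rw [velocity, threePiece, if_neg ((D.a_lt_b ⟨ht.1.le, ht.2⟩).trans hx').not_ge,
      if_neg hx'.not_gt]
    rfl

end FlowData

end TVFlow

end

/-! ### Assembly for a datum of either monotonicity -/

theorem mainTheorem10 (L b₀ χ : ℝ) (hb₀ : 0 < b₀) (hb₀L : b₀ < L)
    (u₀ : ℝ → ℝ) (K : ℝ≥0) (hLip : LipschitzOnWith K u₀ (Icc 0 L))
    (hχ : (χ = 1 ∧ StrictMonoOn u₀ (Icc 0 b₀)) ∨ (χ = -1 ∧ StrictAntiOn u₀ (Icc 0 b₀)))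
    (hflat : ∀ x ∈ Icc b₀ L, u₀ x = u₀ L)
    (U₀ : TVFlow.H L) (hU₀ : U₀.fst =ᵐ[volume.restrict (Ioo 0 L)] u₀)
    (hV₀ : ∀ i, U₀.snd i = u₀ (TVFlow.endpt L i)) :
    ∃ U : ℝ → TVFlow.H L,
      -- `U = (u, v)` is the unique solution
      TVFlow.IsGradientFlow (TVFlow.energy L) U₀ U ∧
      (∀ V : ℝ → TVFlow.H L, TVFlow.IsGradientFlow (TVFlow.energy L) U₀ V →
        ∀ t, 0 ≤ t → V t = U t) ∧
      ∃ (T : ℝ) (a b hl hr : ℝ → ℝ),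
        -- `T` is the time when the two facets meet
        0 < T ∧ a T = b T ∧ (∀ t ∈ Ico 0 T, a t < b t) ∧
        -- 1) the facet `[b(t), L]`
        b 0 = b₀ ∧ hr 0 = u₀ L ∧
        (∀ t ∈ Icc 0 T, b t ∈ Icc 0 b₀ ∧ u₀ (b t) = hr t) ∧
        (∀ t ∈ Ico 0 T, HasDerivWithinAt hr (-χ / (1 + L - b t)) (Ici 0) t) ∧
        (∀ t ∈ Ico 0 T,
          TVFlow.IsCalibrable 1 L {0, L} (b t) L (fun _ => -χ) ∧
          TVFlow.IsCoherent 1 L {0, L} (b t) L (fun _ => -χ)) ∧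
        -- 2) the facet `[0, a(t)]`
        a 0 = 0 ∧ hl 0 = u₀ 0 ∧ (∀ t ∈ Ioc 0 T, 0 < a t) ∧
        (∀ t ∈ Icc 0 T, a t ∈ Icc 0 b₀ ∧ u₀ (a t) = hl t) ∧
        (∀ t ∈ Ico 0 T, HasDerivWithinAt hl (χ / (1 + a t)) (Ici 0) t) ∧
        HasDerivWithinAt hl χ (Ici 0) 0 ∧
        ContinuousWithinAt (fun t => derivWithin hl (Ici 0) t) (Ici 0) 0 ∧
        (∀ t ∈ Ioo 0 T,
          TVFlow.IsCalibrable 1 L {0, L} 0 (a t) (fun _ => χ) ∧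
          TVFlow.IsCoherent 1 L {0, L} 0 (a t) (fun _ => χ)) ∧
        -- 3) the formula for the solution, up to time `T` and afterwards
        (∀ t ∈ Icc 0 T,
          (U t).fst =ᵐ[volume.restrict (Ioo 0 L)]
            TVFlow.threePiece (a t) (b t) (hl t) (hr t) u₀ ∧
          (U t).snd 0 = hl t ∧ (U t).snd 1 = hr t) ∧
        (∀ t, T ≤ t →
          (U t).fst =ᵐ[volume.restrict (Ioo 0 L)] (fun _ => hl T) ∧
          ∀ i, (U t).snd i = hl T) ∧
        -- the velocity `(u_t, v_t)` (right derivative in `H`)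
        (∀ t ∈ Ico 0 T, ∃ W : TVFlow.H L, HasDerivWithinAt U W (Ici t) t ∧
          W.fst =ᵐ[volume.restrict (Ioo 0 L)]
            TVFlow.threePiece (a t) (b t) (χ / (1 + a t)) (-χ / (1 + L - b t)) (fun _ => 0) ∧
          W.snd 0 = χ / (1 + a t) ∧ W.snd 1 = -χ / (1 + L - b t)) ∧
        -- `γ u = v` for all `t ≥ 0` and `γ u_t = v_t` for all `t > 0`
        (∀ t, 0 ≤ t → TVFlow.totalVar L (U t).fst < ∞ ∧
          ∀ i, TVFlow.HasTrace L (U t).fst i ((U t).snd i)) ∧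
        (∀ t, 0 < t → ∃ W : TVFlow.H L, HasDerivWithinAt U W (Ici t) t ∧
          ∀ i, TVFlow.HasTrace L W.fst i (W.snd i)) := by
  have hsign : χ = 1 ∨ χ = -1 := hχ.imp And.left And.left
  have habs : |χ| = 1 := by rcases hsign with h | h <;> simp [h]
  have hsq : χ * χ = 1 := by rcases hsign with h | h <;> simp [h]
  have hmono : StrictMonoOn (fun x => χ * u₀ x) (Icc 0 b₀) := by
    intro x hx y hy hxy
    rcases hχ with ⟨rfl, h⟩ | ⟨rfl, h⟩
    · simpa using h hx hy hxy
    · simpa using h hx hy hxy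
  have hlip : LipschitzOnWith K (fun x => χ * u₀ x) (Icc 0 L) := by
    refine LipschitzOnWith.of_dist_le_mul fun x hx y hy => ?_
    rw [Real.dist_eq, ← mul_sub, abs_mul, habs, one_mul, ← Real.dist_eq]
    exact hLip.dist_le_mul x hx y hy
  -- These heights belong to the increasing profile χu₀; the heights of the solution itself are χ
  -- times them, since χ² = 1.
  obtain ⟨T, a, b, hl, hr, hM⟩ := TVFlow.exists_facetMotion hb₀ hb₀L
    (hlip.continuousOn.mono (Icc_subset_Icc_right hb₀L.le)) hmono
  have D : TVFlow.FlowData L b₀ χ (fun x => χ * u₀ x) K T a b hl hr :=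
    { hM with
      β_pos := hb₀
      β_lt := hb₀L
      lip := hlip
      mono := hmono
      flat := fun x hx => by rw [hflat x hx]
      sign := hsign }
  have hT := D.time_pos
  have hcancel : ∀ {x y : ℝ}, χ * x = y → x = χ * y := fun {x y} h => by
    rw [← h, ← mul_assoc, hsq, one_mul]
  have hb_pos : ∀ t ∈ Ico 0 T, 0 < b t := fun t ht => (D.a_mem t).1.trans_lt (D.a_lt_b ht)
  have hhl : ∀ t, HasDerivWithinAt (fun t => χ * hl t) (χ / (1 + a t)) (Ici 0) t := fun t => by
    rw [div_eq_mul_one_div]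
    exact ((D.hl_deriv t).const_mul χ).hasDerivWithinAt
  have hhr : ∀ t, HasDerivWithinAt (fun t => χ * hr t) (-χ / (1 + L - b t)) (Ici 0) t := fun t => by
    rw [show -χ / (1 + L - b t) = χ * -(1 / (1 + L - b t)) by ring]
    exact ((D.hr_deriv t).const_mul χ).hasDerivWithinAt
  have hprofile : ∀ t ∈ Icc 0 T, (D.flow t).fst =ᵐ[volume.restrict (Ioo 0 L)]
      TVFlow.threePiece (a t) (b t) (χ * hl t) (χ * hr t) u₀ := fun t ht => by
    filter_upwards [D.flow_fst t, ae_restrict_mem measurableSet_Ioo] with x h1 hx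
    rw [h1, D.profile_eq_threePiece ht (Ioo_subset_Icc_self hx)]
    unfold TVFlow.threePiece
    split_ifs
    · rfl
    · rw [← mul_assoc, hsq, one_mul]
    · rfl
  have hinit : D.flow 0 = U₀ := by
    refine TVFlow.H_ext ?_ fun i => ?_
    · filter_upwards [hprofile 0 ⟨le_rfl, hT.le⟩, hU₀, ae_restrict_mem measurableSet_Ioo]
        with x h1 h2 hx
      rw [h1, h2, TVFlow.threePiece, D.a_zero, D.b_zero, if_neg hx.1.not_ge]
      split_ifs with h
      · rfl
      · rw [D.hr_zero, ← hcancel rfl, hflat x ⟨le_of_not_gt h, hx.2.le⟩,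
          hflat b₀ ⟨le_rfl, hb₀L.le⟩]
    · rw [hV₀]
      fin_cases i
      · show χ * hl (min 0 T) = u₀ 0
        rw [min_eq_left hT.le, D.hl_zero, ← hcancel rfl]
      · show χ * hr (min 0 T) = u₀ L
        rw [min_eq_left hT.le, D.hr_zero, ← hcancel rfl, hflat b₀ ⟨le_rfl, hb₀L.le⟩]
  have hflow : TVFlow.IsGradientFlow (TVFlow.energy L) U₀ D.flow := by
    rw [← hinit]; exact D.isGradientFlow_flow
  refine ⟨D.flow, hflow, fun V hV t ht => hV.unique hflow ht, T, a, b, fun t => χ * hl t,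
    fun t => χ * hr t, hT, D.meet, fun t ht => D.a_lt_b ht, D.b_zero, ?_,
    fun t ht => ⟨D.b_mem t, hcancel (D.f_b t ht)⟩, fun t _ => hhr t,
    fun t ht => TVFlow.right_facet_calibrable_coherent (hb_pos t ht) (D.b_lt t) hsign,
    D.a_zero, ?_, fun t ht => D.a_pos ht, fun t ht => ⟨D.a_mem t, hcancel (D.f_a t ht)⟩,
    fun t _ => hhl t, ?_, ?_, fun t ht => TVFlow.left_facet_calibrable_coherent
      (D.a_pos ⟨ht.1, ht.2.le⟩) ((D.a_mem t).2.trans_lt hb₀L) hsign,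
    fun t ht => ⟨hprofile t ht, ?_, ?_⟩, fun t ht => ⟨?_, fun i => ?_⟩,
    fun t ht => ⟨D.flowVelocity t, D.hasDerivWithinAt_flow ht, D.flowVelocity_fst t,
      D.flowVelocity_snd_zero t, D.flowVelocity_snd_one t⟩,
    fun t ht => ⟨(D.totalVar_flow_le ht).trans_lt ENNReal.ofReal_lt_top, D.hasTrace_flow ht⟩,
    fun t ht => ?_⟩
  · simp only [D.hr_zero, ← mul_assoc, hsq, one_mul]
    exact hflat b₀ ⟨le_rfl, hb₀L.le⟩
  · simp only [D.hl_zero, ← mul_assoc, hsq, one_mul]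
  · simpa [D.a_zero] using hhl 0
  · have hcont : Continuous fun t => χ / (1 + a t) := by
      refine continuous_const.div (continuous_const.add D.a_cont) fun t => ?_
      linarith [(D.a_mem t).1]
    have hval : ∀ t ∈ Ici (0 : ℝ),
        derivWithin (fun t => χ * hl t) (Ici 0) t = χ / (1 + a t) := fun t ht =>
      (hhl t).derivWithin (uniqueDiffOn_Ici 0 t ht)
    exact hcont.continuousWithinAt.congr hval (hval 0 self_mem_Ici)
  · rw [D.flow_snd_zero, min_eq_left ht.2]
  · rw [D.flow_snd_one, min_eq_left ht.2]
  · rw [D.flow_eq_of_ge ht]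
    filter_upwards [D.flow_fst T] with x hx
    -- With equal heights the truncation leaves only the common value, whatever u₀ is.
    rw [hx, TVFlow.profile, min_self, ← D.meet_height, max_eq_left (min_le_left _ _)]
  · rw [D.flow_eq_of_ge ht]
    fin_cases i
    · show χ * hl (min T T) = χ * hl T
      rw [min_self]
    · show χ * hr (min T T) = χ * hl T
      rw [min_self, D.meet_height]
  · rcases lt_or_ge t T with h | h
    · exact ⟨_, D.hasDerivWithinAt_flow ⟨ht.le, h⟩, D.hasTrace_flowVelocity ⟨ht, h⟩⟩
    · refine ⟨0, D.hasDerivWithinAt_flow_of_ge h, fun i => ?_⟩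
      refine TVFlow.hasTrace_congr D.L_pos (v := fun _ => 0)
        (Lp.coeFn_zero ℝ 2 (volume.restrict (Ioo 0 L)))
        (TVFlow.hasTrace_of_tendsto D.L_pos integrableOn_zero ?_)
      exact tendsto_const_nhds
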